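/- Let $G$ be any topological group. Work in the category $\mathscr U$ of compactly generated weak Hausdorff spaces; a $G$-space is an object $X$ of $\mathscr U$ with an action of $G$ such that $G\times X\to X$ is continuous for the compactly generated product topology, and a $G$-map is a continuous equivariant map. A $G$-map $i\colon A\to B$ is a $G$-cofibration if it has the $G$-homotopy extension property: for every $G$-space $Z$, every $G$-map $h\colon B\to Z$ and every $G$-homotopy $H\colon A\times[0,1]\to Z$ with $H(a,0)=h(i(a))$, there is a $G$-homotopy $H'\colon B\times[0,1]\to Z$ with $H'(b,0)=h(b)$ and $H'(i(a),t)=H(a,t)$. For a simplicial $G$-space $X_\bullet$ the $n$th latching space is the $G$-subspace $L_nX=\bigcup_{i=0}^{n-1}s_i(X_{n-1})\subset X_n$ (so $L_0X=\emptyset$), and $X_\bullet$ is Reedy cofibrant if the inclusion $L_nX\to X_n$ is a $G$-cofibration for each $n\ge 0$. The geometric realization $|X_\bullet|$ is the quotient of $\coprod_n X_n\times\Delta^n$ by the equivalence relation generated by $(\alpha^*x,t)\sim(x,\alpha_*t)$ for all morphisms $\alpha$ of the simplex category, with $G$ acting through the spaces $X_n$. Theorem. Let $f_\bullet\colon X_\bullet\to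 Y_\bullet$ be a map of Reedy cofibrant simplicial $G$-spaces such that each $f_n\colon X_n\to Y_n$ is a $G$-cofibration. Then $|X_\bullet|$ and $|Y_\bullet|$ are $G$-spaces and the realization $|f_\bullet|\colon|X_\bullet|\to|Y_\bullet|$ is a $G$-cofibration. -/

import Mathlib

open CategoryTheory Opposite Topology
open scoped unitInterval

universe u

/-- A (possibly non-Hausdorff) group whose multiplication is continuous for the compactly generated
product topology `k(G × G)` and whose inversion is continuous.  Every topological group is one, and
so is every group object in compactly generated weak Hausdorff spaces. -/
class IsKTopologicalGroup (G : Type u) [Group G] [TopologicalSpace G] : Prop where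
  continuous_mul : Continuous[TopologicalSpace.compactlyGenerated.{u} (G × G), inferInstance]
    (fun p : G × G => p.1 * p.2)
  continuous_inv : Continuous (fun g : G => g⁻¹)

instance IsTopologicalGroup.isKTopologicalGroup (G : Type u) [Group G] [TopologicalSpace G]
    [IsTopologicalGroup G] : IsKTopologicalGroup G where
  continuous_mul := continuous_from_compactlyGenerated _
    (fun _ g => (_root_.continuous_mul (M := G)).comp g.continuous)
  continuous_inv := ContinuousInv.continuous_inv

/-- Weak Hausdorff: the continuous image of every compact Hausdorff space is closed. -/
def IsWeakHausdorff (X : Type u) [TopologicalSpace X] : Prop :=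
  ∀ (K : Type u) [TopologicalSpace K] [CompactSpace K] [T2Space K] (a : K → X),
    Continuous a → IsClosed (Set.range a)

/-- A set `X` with a topology and an action of `G` is a `G`-space: it is compactly generated and
weak Hausdorff, and the action is continuous for the compactly generated product `k(G × X)`. -/
structure IsGSpace (G : Type u) [Group G] [TopologicalSpace G]
    (X : Type u) [TopologicalSpace X] [MulAction G X] : Prop where
  compactlyGenerated : CompactlyGeneratedSpace X
  weakHausdorff : IsWeakHausdorff X
  continuous_smul : Continuous[TopologicalSpace.compactlyGenerated.{u} (G × X), inferInstance]
    (fun p : G × X => p.1 • p.2)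

/-- A `G`-cofibration: a `G`-map with the `G`-homotopy extension property with respect to all
`G`-spaces.  (The product of a compactly generated space with the unit interval is already
compactly generated, so the ordinary product topology is the right one here.) -/
structure IsGCofibration (G : Type u) [Group G] [TopologicalSpace G]
    {A B : Type u} [TopologicalSpace A] [TopologicalSpace B] [MulAction G A] [MulAction G B]
    (i : A → B) : Prop where
  continuous : Continuous i
  map_smul : ∀ (g : G) (a : A), i (g • a) = g • i a
  homotopy_extension : ∀ (Z : Type u) [TopologicalSpace Z] [MulAction G Z], IsGSpace G Z →
    ∀ (h : B → Z) (H : A × I → Z),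
      Continuous h → (∀ (g : G) (b : B), h (g • b) = g • h b) →
      Continuous H → (∀ (g : G) (a : A) (t : I), H (g • a, t) = g • H (a, t)) →
      (∀ a : A, H (a, 0) = h (i a)) →
      ∃ H' : B × I → Z, Continuous H' ∧
        (∀ (g : G) (b : B) (t : I), H' (g • b, t) = g • H' (b, t)) ∧
        (∀ b : B, H' (b, 0) = h b) ∧ (∀ (a : A) (t : I), H' (i a, t) = H (a, t))

/-- The category of `G`-spaces: objects. -/
structure GSpaceCat (G : Type u) [Group G] [TopologicalSpace G] : Type (u + 1) where
  carrier : Type u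
  [topologicalSpace : TopologicalSpace carrier]
  [mulAction : MulAction G carrier]
  isGSpace : IsGSpace G carrier

namespace GSpaceCat

variable {G : Type u} [Group G] [TopologicalSpace G]

instance : CoeSort (GSpaceCat G) (Type u) := ⟨GSpaceCat.carrier⟩

attribute [instance] GSpaceCat.topologicalSpace GSpaceCat.mulAction

/-- The category of `G`-spaces: morphisms are the `G`-maps. -/
@[ext]
structure Hom (X Y : GSpaceCat G) : Type u where
  toFun : X → Y
  continuous : Continuous toFun
  map_smul : ∀ (g : G) (x : X), toFun (g • x) = g • toFun x

instance : Category.{u} (GSpaceCat G) where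
  Hom X Y := Hom X Y
  id X := ⟨fun x => x, continuous_id, fun _ _ => rfl⟩
  comp f g := ⟨fun x => g.toFun (f.toFun x), g.continuous.comp f.continuous,
    fun a x => by rw [f.map_smul, g.map_smul]⟩

end GSpaceCat

namespace SimplicialGSpace

variable {G : Type u} [Group G] [TopologicalSpace G]

/-- The underlying set of the `n`th latching space: the union of the images of the degeneracies
`s_i : X_{n-1} → X_n`, for `0 ≤ i ≤ n - 1` (empty for `n = 0`). -/
def latchingSet (X : SimplicialObject (GSpaceCat G)) : (n : ℕ) → Set (X.obj (op (SimplexCategory.mk n)))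
  | 0 => ∅
  | _ + 1 => ⋃ i, Set.range (X.σ i).toFun

/-- The `n`th latching space, as a `G`-invariant subspace of `X_n`. -/
def latching (X : SimplicialObject (GSpaceCat G)) (n : ℕ) : SubMulAction G (X.obj (op (SimplexCategory.mk n))) where
  carrier := latchingSet X n
  smul_mem' := by
    intro g x hx
    cases n with
    | zero => exact hx.elim
    | succ n =>
      obtain ⟨i, y, rfl⟩ := Set.mem_iUnion.1 hx
      exact Set.mem_iUnion.2 ⟨i, g • y, (X.σ i).map_smul g y⟩

/-- Reedy cofibrancy: the inclusion `L_n X → X_n` is a `G`-cofibration for each `n`. -/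
def IsReedyCofibrant (X : SimplicialObject (GSpaceCat G)) : Prop :=
  ∀ n : ℕ, IsGCofibration G (Subtype.val : latching X n → X.obj (op (SimplexCategory.mk n)))

/-- The disjoint union of the spaces `X_n × Δ^n`. -/
abbrev PreRealization (X : SimplicialObject (GSpaceCat G)) : Type u :=
  Σ n : SimplexCategory, (X.obj (op n)) × (SimplexCategory.toTop₀.obj n)

/-- The relation `(α^* x, t) ∼ (x, α_* t)` for all morphisms `α` of the simplex category. -/
inductive Rel (X : SimplicialObject (GSpaceCat G)) : PreRealization X → PreRealization X → Prop
  | glue {m n : SimplexCategory} (α : m ⟶ n) (x : X.obj (op n)) (t : SimplexCategory.toTop₀.obj m) :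
      Rel X ⟨m, ((X.map α.op).toFun x, t)⟩ ⟨n, (x, SimplexCategory.toTop₀.map α t)⟩

/-- The geometric realization of a simplicial `G`-space: the quotient of the disjoint union of the
`X_n × Δ^n` by the equivalence relation generated by `Rel`, with the quotient topology. -/
def Realization (X : SimplicialObject (GSpaceCat G)) : Type u := Quot (Rel X)

instance (X : SimplicialObject (GSpaceCat G)) : TopologicalSpace (Realization X) :=
  inferInstanceAs (TopologicalSpace (Quot (Rel X)))

/-- The action of `G` on the realization, `g • [x, t] = [g • x, t]`. -/
instance (X : SimplicialObject (GSpaceCat G)) : MulAction G (Realization X) where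
  smul g := Quot.map (fun p => ⟨p.1, (g • p.2.1, p.2.2)⟩) (by
    rintro _ _ ⟨α, x, t⟩
    have h := Rel.glue (X := X) α (g • x) t
    rwa [(X.map α.op).map_smul] at h)
  one_smul := by
    rintro ⟨n, x, t⟩
    exact congrArg (fun y => Quot.mk (Rel X) ⟨n, (y, t)⟩) (one_smul G x)
  mul_smul := by
    rintro a b ⟨n, x, t⟩
    exact congrArg (fun y => Quot.mk (Rel X) ⟨n, (y, t)⟩) (mul_smul a b x)

/-- The geometric realization of a map of simplicial `G`-spaces, `[x, t] ↦ [f_n x, t]`. -/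
def realizationMap {X Y : SimplicialObject (GSpaceCat G)} (f : X ⟶ Y) :
    Realization X → Realization Y :=
  Quot.map (fun p => ⟨p.1, ((f.app (op p.1)).toFun p.2.1, p.2.2)⟩) (by
    rintro _ _ ⟨α, x, t⟩
    have h := Rel.glue (X := Y) α ((f.app _).toFun x) t
    have e : (f.app _).toFun ((X.map α.op).toFun x) = (Y.map α.op).toFun ((f.app _).toFun x) :=
      congrFun (congrArg GSpaceCat.Hom.toFun (f.naturality α.op)) x
    rwa [← e] at h)

end SimplicialGSpace

/-! A homotopy on $|Y|$ is extended one skeleton at a time. The points new in dimension $n$ are the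
classes of $(y,t)$ with $y$ nondegenerate, $y$ not in the image of $f_n$, and $t$ interior. So the
task at stage $n$ is an equivariant extension from $(L_nY\cup f_n(X_n))\times\Delta^n\cup
Y_n\times\partial\Delta^n$ to $Y_n\times\Delta^n$.

That subspace must be an equivariant NDR. Testing a $G$-cofibration against its mapping cylinder
shows that it is a closed embedding whose image carries a Strøm structure
(`IsGCofibration.isEquivariantNDR`). This applies to $L_nY$, to $f_n(X_n)$, and to $L_nY\cap
f_n(X_n)=f_n(L_nX)$, the image of a composite of two cofibrations. Lillig's theorem
(`IsEquivariantNDR.union`) handles the union, and `IsStromStructure.prod` the product with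
$(\Delta^n,\partial\Delta^n)$.

Gluing needs control of the equivalence relation. Two pairs represent the same point exactly when
some point of a third simplex maps to both and the pulled back simplices agree
(`Realization.mk_eq_mk_iff`). This makes nondegenerate representatives unique and $|f|$ injective.
It also makes the relation closed over compact test spaces, hence $|X|$ weak Hausdorff.

Topological statements are checked on maps from compact Hausdorff spaces. This is what permits
ordinary products with $I$ and $\Delta^n$. -/

/-! ### Compact Hausdorff test maps -/

/-- A family of continuous maps from compact Hausdorff spaces to `Q` which is jointly surjective and
detects closed subsets of `Q`. -/
structure IsGenerating {Q : Type u} [TopologicalSpace Q]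
    (T : ∀ S : CompHaus.{u}, (S → Q) → Prop) : Prop where
  continuous : ∀ {S : CompHaus.{u}} {c : S → Q}, T S c → Continuous c
  exists_mem_range : ∀ y : Q, ∃ (S : CompHaus.{u}) (c : S → Q), T S c ∧ y ∈ Set.range c
  isClosed : ∀ C : Set Q, (∀ (S : CompHaus.{u}) (c : S → Q), T S c → IsClosed (c ⁻¹' C)) →
    IsClosed C

namespace IsGenerating

variable {Q : Type u} [TopologicalSpace Q] {T : ∀ S : CompHaus.{u}, (S → Q) → Prop}

theorem of_compactlyGenerated (X : Type u) [TopologicalSpace X] (hX : CompactlyGeneratedSpace X) :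
    IsGenerating (Q := X) (fun _ c => Continuous c) where
  continuous h := h
  exists_mem_range y := ⟨CompHaus.of PUnit, fun _ => y, continuous_const, ⟨⟨⟩, rfl⟩⟩
  isClosed _ h := CompactlyGeneratedSpace.isClosed' fun S _ _ _ f hf => h (CompHaus.of S) f hf

/-- A tube argument: around a point outside `C`, choose a compact neighbourhood `N` in `K` whose
slice misses `C`. The points of `Q` whose slice over `N` meets `C` form a closed set, since on each
test space this set is a projection along a compact factor. -/
theorem isClosed_prod (hT : IsGenerating T) {K : Type*} [TopologicalSpace K] [CompactSpace K]
    [T2Space K] (C : Set (Q × K))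
    (h : ∀ (S : CompHaus.{u}) (c : S → Q), T S c →
      IsClosed ((fun p : S × K => (c p.1, p.2)) ⁻¹' C)) : IsClosed C := by
  rw [← isOpen_compl_iff, isOpen_iff_mem_nhds]
  rintro ⟨y, k⟩ hyk
  obtain ⟨S, c, hc, s, rfl⟩ := hT.exists_mem_range y
  have h1 : IsOpen {k' : K | (c s, k') ∉ C} :=
    (((h S c hc).preimage (Continuous.prodMk_right s))).isOpen_compl
  obtain ⟨N, hN, hkN, hNC⟩ := exists_compact_subset h1 hyk
  have h2 : IsClosed {y : Q | ∃ k ∈ N, (y, k) ∈ C} := by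
    refine hT.isClosed _ fun S c hc => ?_
    have := isClosedMap_fst_of_compactSpace _
      ((h S c hc).inter (hN.isClosed.preimage (continuous_snd (X := S))))
    convert this using 1
    ext s
    simp only [Set.mem_preimage, Set.mem_ofPred_eq, Set.mem_image, Set.mem_inter_iff, Prod.exists,
      exists_and_right, exists_eq_right]
    exact ⟨fun ⟨k, h1, h2⟩ => ⟨k, h2, h1⟩, fun ⟨k, h1, h2⟩ => ⟨k, h2, h1⟩⟩
  have h3 : {y : Q | ∃ k ∈ N, (y, k) ∈ C}ᶜ ∈ 𝓝 (c s) :=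
    h2.isOpen_compl.mem_nhds fun ⟨k', hk', hC⟩ => hNC hk' hC
  have h4 : N ∈ 𝓝 k := mem_interior_iff_mem_nhds.1 hkN
  filter_upwards [prod_mem_nhds h3 h4] with p hp hC
  exact hp.1 ⟨p.2, hp.2, hC⟩

theorem continuous_prod (hT : IsGenerating T) {K : Type*} [TopologicalSpace K] [CompactSpace K]
    [T2Space K] {W : Type*} [TopologicalSpace W] (f : Q × K → W)
    (h : ∀ (S : CompHaus.{u}) (c : S → Q), T S c →
      Continuous (fun p : S × K => f (c p.1, p.2))) : Continuous f :=
  continuous_iff_isClosed.2 fun _ hC => hT.isClosed_prod _ fun S c hc => hC.preimage (h S c hc)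

theorem continuous_of (hT : IsGenerating T) {W : Type*} [TopologicalSpace W] (f : Q → W)
    (h : ∀ (S : CompHaus.{u}) (c : S → Q), T S c → Continuous (fun s : S => f (c s))) :
    Continuous f :=
  continuous_iff_isClosed.2 fun _ hC => hT.isClosed _ fun S c hc => hC.preimage (h S c hc)

theorem compactlyGeneratedSpace (hT : IsGenerating T) : CompactlyGeneratedSpace Q :=
  compactlyGeneratedSpace_of_isClosed fun C h => hT.isClosed C fun S c hc => by
    exact h S c (hT.continuous hc)

/-- Applying `isClosed_prod` in one variable and then in the other makes the graph of `b` closed in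
`Q × K`. Its projection along the compact `K` is the range of `b`. -/
theorem isWeakHausdorff (hT : IsGenerating T)
    (h : ∀ (S S' : CompHaus.{u}) (c : S → Q) (c' : S' → Q), T S c → T S' c' →
      IsClosed {p : S × S' | c p.1 = c' p.2}) : IsWeakHausdorff Q := by
  intro K _ _ _ b hb
  have h1 : IsClosed {p : Q × K | p.1 = b p.2} := by
    refine hT.isClosed_prod _ fun S c hc => ?_
    have h2 : IsClosed {p : Q × S | p.1 = c p.2} :=
      hT.isClosed_prod _ fun S' c' hc' => h S' S c' c hc' hc
    have h3 := h2.preimage (show Continuous fun p : S × K => (b p.2, p.1) by fun_prop)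
    convert h3 using 1
    ext p
    exact eq_comm
  convert isClosedMap_fst_of_compactSpace _ h1 using 1
  ext y
  constructor
  · rintro ⟨k, rfl⟩
    exact ⟨(b k, k), rfl, rfl⟩
  · rintro ⟨⟨y, k⟩, hk, rfl⟩
    exact ⟨k, (show y = b k from hk).symm⟩

theorem isGSpace {G : Type u} [Group G] [TopologicalSpace G] [MulAction G Q]
    (hT : IsGenerating T)
    (h : ∀ (S S' : CompHaus.{u}) (c : S → Q) (c' : S' → Q), T S c → T S' c' →
      IsClosed {p : S × S' | c p.1 = c' p.2})
    (hact : ∀ (S K : CompHaus.{u}) (c : S → Q) (g : K → G), T S c → Continuous g →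
      Continuous fun p : S × K => g p.2 • c p.1) : IsGSpace G Q where
  compactlyGenerated := hT.compactlyGeneratedSpace
  weakHausdorff := hT.isWeakHausdorff h
  continuous_smul := continuous_from_compactlyGenerated _ fun S g => by
    have := hT.continuous_prod (K := S) (fun p : Q × S => (g p.2).1 • p.1) fun S' c hc =>
      hact S' S c (fun s => (g s).1) hc (continuous_fst.comp g.continuous)
    -- The action along a test map to `G × Q` factors through `Q × S`, where only the group element
    -- is parametrised by the compact space.
    exact this.comp (show Continuous fun s : S => ((g s).2, s) by fun_prop)

end IsGenerating

/-! ### Weak Hausdorff spaces and G-spaces -/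

theorem IsWeakHausdorff.isClosed_singleton {X : Type u} [TopologicalSpace X]
    (hX : IsWeakHausdorff X) (x : X) : IsClosed {x} := by
  have := hX PUnit (fun _ => x) continuous_const
  rwa [Set.range_const] at this

theorem IsWeakHausdorff.isClosedMap {X : Type u} [TopologicalSpace X] (hX : IsWeakHausdorff X)
    {K : Type u} [TopologicalSpace K] [CompactSpace K] [T2Space K] {a : K → X}
    (ha : Continuous a) : IsClosedMap a := by
  intro C hC
  have : CompactSpace C := isCompact_iff_compactSpace.1 hC.isCompact
  have := hX C (fun c => a c) (ha.comp continuous_subtype_val)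
  rwa [show (fun c : C => a c) = a ∘ Subtype.val from rfl, Set.range_comp,
    Subtype.range_coe] at this

/-- The map `c` on `K ⊕ K` is closed, so disjoint open neighbourhoods of its fibres over `a k` and
`b k` contain the whole fibres over `a k'` and `b k'` for `k'` near `k`. If `a k' = b k'`, then
`Sum.inl k'` would lie in both. -/
theorem IsWeakHausdorff.isClosed_eq {X : Type u} [TopologicalSpace X] (hX : IsWeakHausdorff X)
    {K : Type u} [TopologicalSpace K] [CompactSpace K] [T2Space K] {a b : K → X}
    (ha : Continuous a) (hb : Continuous b) : IsClosed {k | a k = b k} := by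
  rw [← isOpen_compl_iff, isOpen_iff_mem_nhds]
  intro k hk
  let c : K ⊕ K → X := Sum.elim a b
  have hc : Continuous c := ha.sumElim hb
  have hcl := hX.isClosedMap hc
  have hd : Disjoint (c ⁻¹' {a k}) (c ⁻¹' {b k}) :=
    Disjoint.preimage _ (Set.disjoint_singleton.2 hk)
  obtain ⟨U, V, hU, hV, haU, hbV, hUV⟩ := SeparatedNhds.of_isCompact_isCompact
    ((hX.isClosed_singleton (a k)).preimage hc).isCompact
    ((hX.isClosed_singleton (b k)).preimage hc).isCompact hd
  have h1 : IsOpen (a ⁻¹' (c '' Uᶜ)ᶜ) := (hcl _ hU.isClosed_compl).isOpen_compl.preimage ha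
  have h2 : IsOpen (b ⁻¹' (c '' Vᶜ)ᶜ) := (hcl _ hV.isClosed_compl).isOpen_compl.preimage hb
  have h3 : k ∈ a ⁻¹' (c '' Uᶜ)ᶜ := fun ⟨x, hxU, hx⟩ => hxU (haU hx)
  have h4 : k ∈ b ⁻¹' (c '' Vᶜ)ᶜ := fun ⟨x, hxV, hx⟩ => hxV (hbV hx)
  filter_upwards [h1.mem_nhds h3, h2.mem_nhds h4] with k' h5 h6 h7
  have h8 : Sum.inl k' ∈ U := by
    by_contra h
    exact h5 ⟨Sum.inl k', h, rfl⟩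
  have h9 : Sum.inl k' ∈ V := by
    by_contra h
    exact h6 ⟨Sum.inl k', h, h7⟩
  exact Set.disjoint_left.1 hUV h8 h9

theorem IsClosed.compactlyGeneratedSpace {X : Type u} [TopologicalSpace X]
    (hX : CompactlyGeneratedSpace X) {A : Set X} (hA : IsClosed A) : CompactlyGeneratedSpace A := by
  refine compactlyGeneratedSpace_of_isClosed fun C h => ?_
  rw [hA.isClosedEmbedding_subtypeVal.isClosed_iff_image_isClosed]
  refine CompactlyGeneratedSpace.isClosed' fun K _ _ _ a ha => ?_
  have hK : IsClosed (a ⁻¹' A) := hA.preimage ha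
  have : CompactSpace (a ⁻¹' A) := isCompact_iff_compactSpace.1 hK.isCompact
  have h1 := h (a ⁻¹' A) (fun k => (⟨a k, k.2⟩ : A)) (by fun_prop)
  rw [hK.isClosedEmbedding_subtypeVal.isClosed_iff_image_isClosed] at h1
  convert h1 using 1
  ext k
  simp

theorem IsWeakHausdorff.subtype {X : Type u} [TopologicalSpace X]
    (hX : IsWeakHausdorff X) (A : Set X) : IsWeakHausdorff A := by
  intro K _ _ _ a ha
  have := (hX K (fun k => (a k : X)) (continuous_subtype_val.comp ha)).preimage
    (continuous_subtype_val (p := (· ∈ A)))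
  convert this using 1
  ext x
  simp [Subtype.ext_iff]

namespace IsGSpace

variable {G : Type u} [Group G] [TopologicalSpace G] {X : Type u} [TopologicalSpace X]
  [MulAction G X]

theorem isGenerating (hX : IsGSpace G X) : IsGenerating (Q := X) (fun _ c => Continuous c) :=
  IsGenerating.of_compactlyGenerated X hX.compactlyGenerated

theorem isClosed_eq (hX : IsGSpace G X) {W : Type u} [TopologicalSpace W]
    (hW : CompactlyGeneratedSpace W) {a b : W → X} (ha : Continuous a) (hb : Continuous b) :
    IsClosed {w | a w = b w} :=
  (IsGenerating.of_compactlyGenerated W hW).isClosed _ fun _ _ hc =>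
    hX.weakHausdorff.isClosed_eq (ha.comp hc) (hb.comp hc)

theorem continuous_smul_of_compact (hX : IsGSpace G X) {K : Type u} [TopologicalSpace K]
    [CompactSpace K] [T2Space K] {g : K → G} {x : K → X} (hg : Continuous g) (hx : Continuous x) :
    Continuous fun k => g k • x k := by
  have := hX.continuous_smul
  rw [continuous_coinduced_dom, continuous_sigma_iff] at this
  exact this ⟨CompHaus.of K, ⟨fun k => (g k, x k), by fun_prop⟩⟩

end IsGSpace

/-! ### Strøm structures and equivariant NDRs -/

theorem unitInterval.zero_min (s : I) : min 0 s = 0 :=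
  min_eq_left (unitInterval.nonneg s)

theorem unitInterval.min_zero (s : I) : min s 0 = 0 :=
  min_eq_right (unitInterval.nonneg s)

/-- A Strøm structure on a closed subset `A` of a space `B` with an action `act`: an invariant
function `v` vanishing on `A` and an equivariant deformation `φ` of `B` relative to `A` which has
moved `b` into `A` at all times later than `v b`. -/
structure IsStromStructure {G B : Type*} [TopologicalSpace B] (act : G → B → B) (A : Set B)
    (v : B → I) (φ : B × I → B) : Prop where
  isClosed : IsClosed A
  continuous_fun : Continuous v
  continuous_deformation : Continuous φ
  fun_act : ∀ g b, v (act g b) = v b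
  deformation_act : ∀ g b t, φ (act g b, t) = act g (φ (b, t))
  deformation_zero : ∀ b, φ (b, 0) = b
  fun_eq_zero : ∀ a ∈ A, v a = 0
  deformation_eq : ∀ a ∈ A, ∀ t, φ (a, t) = a
  mem_of_lt : ∀ b t, v b < t → φ (b, t) ∈ A

/-- A closed subset of a space with an action is an equivariant NDR if it admits a Strøm
structure. -/
def IsEquivariantNDR {G B : Type*} [TopologicalSpace B] (act : G → B → B) (A : Set B) : Prop :=
  ∃ (v : B → I) (φ : B × I → B), IsStromStructure act A v φ

namespace IsStromStructure

variable {G B : Type*} [TopologicalSpace B] {act : G → B → B} {A : Set B} {v : B → I}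
  {φ : B × I → B}

/-- At time `t = v b` the point is a limit of the points at later times, which lie in the closed set
`A`. The condition `v b < 1` guarantees that later times exist. -/
theorem mem_of_le (h : IsStromStructure act A v φ) {b : B} {t : I} (hb : v b < 1)
    (ht : v b ≤ t) : φ (b, t) ∈ A := by
  rcases ht.lt_or_eq with h1 | h1
  · exact h.mem_of_lt b t h1
  · have h2 : t ∈ closure (Set.Ioi t) := by
      rw [closure_Ioi' ⟨1, h1 ▸ hb⟩]
      exact Set.self_mem_Ici
    have h3 := map_mem_closure (f := fun t => φ (b, t)) (t := A)
      (h.continuous_deformation.comp (Continuous.prodMk_right b)) h2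
      fun s hs => h.mem_of_lt b s (h1 ▸ hs)
    rwa [h.isClosed.closure_eq] at h3

theorem mem_iff (h : IsStromStructure act A v φ) (b : B) : b ∈ A ↔ v b = 0 := by
  refine ⟨h.fun_eq_zero b, fun hb => ?_⟩
  rw [← h.deformation_zero b]
  exact h.mem_of_le (by rw [hb]; exact zero_lt_one) hb.le

-- The pair `f`, `H` is composed with a retraction of `B × I` onto `B × 0 ∪ A × I`. The last clause
-- records that no other values occur, which is needed to build retractions with controlled image.
open Classical in
theorem exists_extension (h : IsStromStructure act A v φ) {Z : Type*} [TopologicalSpace Z]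
    (actZ : G → Z → Z) {f : B → Z} {H : B × I → Z} (hf : Continuous f)
    (hH : ContinuousOn H (A ×ˢ Set.univ)) (hfact : ∀ g b, f (act g b) = actZ g (f b))
    (hHact : ∀ g, ∀ a ∈ A, ∀ t, H (act g a, t) = actZ g (H (a, t)))
    (h0 : ∀ a ∈ A, H (a, 0) = f a) :
    ∃ H' : B × I → Z, Continuous H' ∧ (∀ g b t, H' (act g b, t) = actZ g (H' (b, t))) ∧
      (∀ b, H' (b, 0) = f b) ∧ (∀ a ∈ A, ∀ t, H' (a, t) = H (a, t)) ∧
      ∀ b t, (∃ b', H' (b, t) = f b') ∨ ∃ a ∈ A, ∃ t', H' (b, t) = H (a, t') := by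
  let P : B × I → Z := fun p => if p.2 = 0 then f p.1 else H p
  let S : Set (B × I) := {p | p.2 = 0} ∪ A ×ˢ Set.univ
  have hP : ContinuousOn P S := by
    refine ContinuousOn.union_of_isClosed ?_ ?_ (isClosed_eq continuous_snd continuous_const)
      (h.isClosed.prod isClosed_univ)
    · exact (hf.comp continuous_fst).continuousOn.congr fun p hp => if_pos hp
    · refine hH.congr fun p hp => ?_
      by_cases h2 : p.2 = 0
      · rw [show P p = f p.1 from if_pos h2, ← h0 p.1 hp.1, ← h2]
      · exact if_neg h2
  -- The clock first drives `φ` up to time `v b`; only the time left over is passed on as the second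
  -- coordinate.
  let s : B × I → I := fun p => ⟨(p.2 : ℝ) - min (p.2 : ℝ) (v p.1),
    sub_nonneg.2 (min_le_left _ _), by
      have := p.2.2.2
      have : (0 : ℝ) ≤ min (p.2 : ℝ) (v p.1) := le_min p.2.2.1 (v p.1).2.1
      linarith⟩
  let R : B × I → B × I := fun p => (φ (p.1, min p.2 (v p.1)), s p)
  have hv := h.continuous_fun
  have hφ := h.continuous_deformation
  have hs : Continuous s := by
    refine Continuous.subtype_mk ?_ _
    fun_prop
  have hR : Continuous R := by fun_prop
  have hRS : ∀ p, R p ∈ S := fun p => by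
    rcases le_or_gt p.2 (v p.1) with h1 | h1
    · left
      refine Subtype.ext ?_
      change (p.2 : ℝ) - min (p.2 : ℝ) (v p.1) = 0
      rw [min_eq_left (by exact_mod_cast h1), sub_self]
    · right
      refine ⟨?_, trivial⟩
      change φ (p.1, min p.2 (v p.1)) ∈ A
      rw [min_eq_right h1.le]
      exact h.mem_of_le (h1.trans_le (unitInterval.le_one _)) le_rfl
  refine ⟨P ∘ R, hP.comp_continuous hR hRS, ?_, ?_, ?_, ?_⟩
  · intro g b t
    have h1 : R (act g b, t) = (act g (R (b, t)).1, (R (b, t)).2) := by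
      refine Prod.ext ?_ (Subtype.ext ?_)
      · change φ (act g b, min t (v (act g b))) = _
        rw [h.fun_act, h.deformation_act]
      · change (t : ℝ) - min (t : ℝ) (v (act g b)) = t - min (t : ℝ) (v b)
        rw [h.fun_act]
    have h2 := hRS (b, t)
    simp only [Function.comp, h1]
    generalize R (b, t) = q at h2
    obtain ⟨b', t'⟩ := q
    by_cases h3 : t' = 0
    · simp only [P, h3, if_true, hfact]
    · simp only [P, h3, if_false]
      exact hHact g b' (h2.resolve_left h3).1 t'
  · intro b
    have h1 : R (b, 0) = (b, 0) := by
      refine Prod.ext ?_ (Subtype.ext ?_)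
      · change φ (b, min 0 (v b)) = b
        rw [unitInterval.zero_min, h.deformation_zero]
      · change (0 : ℝ) - min (0 : ℝ) (v b) = 0
        rw [min_eq_left (v b).2.1, sub_zero]
    simp only [Function.comp, h1, P, if_true]
  · intro a ha t
    have h1 : R (a, t) = (a, t) := by
      refine Prod.ext ?_ (Subtype.ext ?_)
      · exact h.deformation_eq a ha _
      · change (t : ℝ) - min (t : ℝ) (v a) = t
        rw [h.fun_eq_zero a ha]
        change (t : ℝ) - min (t : ℝ) 0 = t
        rw [min_eq_right t.2.1, sub_zero]
    simp only [Function.comp, h1, P]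
    by_cases h2 : t = 0
    · rw [if_pos h2, ← h0 a ha, h2]
    · rw [if_neg h2]
  · intro b t
    have h2 := hRS (b, t)
    simp only [Function.comp]
    generalize R (b, t) = q at h2
    obtain ⟨b', t'⟩ := q
    by_cases h3 : t' = 0
    · left
      exact ⟨b', if_pos h3⟩
    · right
      exact ⟨b', (h2.resolve_left h3).1, t', if_neg h3⟩

/-- Each factor moves only until the time given by the other factor's function, so it stands still
when the other point already lies in its subset. The factor with the smaller function reaches its
subset; `mem_of_le` is needed because the capped time may equal that function. -/
theorem prod (h : IsStromStructure act A v φ) {K : Type*} [TopologicalSpace K]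
    {actK : G → K → K} {L : Set K} {w : K → I} {ψ : K × I → K}
    (hK : IsStromStructure actK L w ψ) :
    IsStromStructure (fun g (p : B × K) => (act g p.1, actK g p.2)) {p | p.1 ∈ A ∨ p.2 ∈ L}
      (fun p => min (v p.1) (w p.2))
      (fun q => (φ (q.1.1, min q.2 (w q.1.2)), ψ (q.1.2, min q.2 (v q.1.1)))) where
  isClosed := (h.isClosed.preimage continuous_fst).union (hK.isClosed.preimage continuous_snd)
  continuous_fun := (h.continuous_fun.comp continuous_fst).min
    (hK.continuous_fun.comp continuous_snd)
  continuous_deformation := by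
    have := h.continuous_fun
    have := h.continuous_deformation
    have := hK.continuous_fun
    have := hK.continuous_deformation
    fun_prop
  fun_act g b := by simp only [h.fun_act, hK.fun_act]
  deformation_act g b t := by
    simp only [h.fun_act, hK.fun_act, h.deformation_act, hK.deformation_act]
  deformation_zero b := by
    simp only [unitInterval.zero_min, h.deformation_zero, hK.deformation_zero]
  fun_eq_zero := by
    rintro ⟨a, k⟩ (ha | hk)
    · simp only [h.fun_eq_zero a ha, unitInterval.zero_min]
    · simp only [hK.fun_eq_zero k hk, unitInterval.min_zero]
  deformation_eq := by
    rintro ⟨a, k⟩ (ha | hk) t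
    · simp only [h.fun_eq_zero a ha, unitInterval.min_zero, h.deformation_eq a ha,
        hK.deformation_zero]
    · simp only [hK.fun_eq_zero k hk, unitInterval.min_zero,
        hK.deformation_eq k hk, h.deformation_zero]
  mem_of_lt := by
    rintro ⟨b, k⟩ t ht
    rcases le_total (v b) (w k) with h1 | h1
    · rw [min_eq_left h1] at ht
      exact Or.inl (h.mem_of_le (ht.trans_le (unitInterval.le_one _)) (le_min ht.le h1))
    · rw [min_eq_right h1] at ht
      exact Or.inr (hK.mem_of_le (ht.trans_le (unitInterval.le_one _)) (le_min ht.le h1))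

end IsStromStructure

namespace IsEquivariantNDR

variable {G B : Type*} [TopologicalSpace B] {act : G → B → B} {A : Set B}

theorem isClosed (h : IsEquivariantNDR act A) : IsClosed A := by
  obtain ⟨v, φ, h⟩ := h
  exact h.isClosed

/-- The function is $v(b)=\sup_t|t-R_2(b,t)|$, continuous as the norm of a curried map into `C(I,
ℝ)`. If `v b < t` then the second coordinate of `R (b, t)` is nonzero, which forces the first into
`A`. -/
theorem of_retraction (hA : IsClosed A) {R : B × I → B × I} (hR : Continuous R)
    (hact : ∀ g b t, R (act g b, t) = (act g (R (b, t)).1, (R (b, t)).2))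
    (h0 : ∀ b, R (b, 0) = (b, 0)) (hRA : ∀ a ∈ A, ∀ t, R (a, t) = (a, t))
    (hmem : ∀ p, (R p).2 = 0 ∨ (R p).1 ∈ A) : IsEquivariantNDR act A := by
  let d : C(B, C(I, ℝ)) := ContinuousMap.curry ⟨fun p : B × I => (p.2 : ℝ) - (R p).2, by fun_prop⟩
  have hd : ∀ b t, d b t = (t : ℝ) - (R (b, t)).2 := fun _ _ => rfl
  refine ⟨fun b => ⟨‖d b‖, norm_nonneg _, ?_⟩, fun p => (R p).1, hA, ?_, by fun_prop, ?_, ?_, ?_,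
    ?_, ?_, ?_⟩
  · rw [ContinuousMap.norm_le _ zero_le_one]
    intro t
    rw [hd, Real.norm_eq_abs, abs_le]
    have h1 := t.2
    have h2 := (R (b, t)).2.2
    constructor <;> linarith [h1.1, h1.2, h2.1, h2.2]
  · exact (d.continuous.norm).subtype_mk _
  · intro g b
    refine Subtype.ext ?_
    change ‖d (act g b)‖ = ‖d b‖
    congr 1
    ext t
    rw [hd, hd, hact]
  · intro g b t
    simp only [hact]
  · intro b
    simp only [h0]
  · intro a ha
    refine Subtype.ext ?_
    change ‖d a‖ = 0
    rw [norm_eq_zero]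
    ext t
    rw [hd, hRA a ha, sub_self]
    rfl
  · intro a ha t
    simp only [hRA a ha]
  · intro b t ht
    refine (hmem (b, t)).resolve_left fun h1 => ?_
    have h2 := (d b).norm_coe_le_norm t
    rw [hd, h1] at h2
    have h3 : ‖d b‖ < t := ht
    have h4 : ((0 : I) : ℝ) = 0 := rfl
    rw [h4, sub_zero] at h2
    exact absurd (h2.trans_lt h3) (not_lt.2 (le_abs_self _))

end IsEquivariantNDR

/-! ### The simplex and its boundary -/

/-- The boundary of the standard simplex. -/
def stdSimplexBoundary (n : ℕ) : Set (stdSimplex ℝ (Fin (n + 1))) := {t | ∃ i, t i = 0}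

theorem stdSimplex.continuous_eval {ι : Type*} [Fintype ι] (i : ι) :
    Continuous fun t : stdSimplex ℝ ι => t i :=
  (continuous_apply i).comp continuous_subtype_val

theorem isClosed_stdSimplexBoundary (n : ℕ) : IsClosed (stdSimplexBoundary n) := by
  have : stdSimplexBoundary n = ⋃ i, {t | t i = 0} := by
    ext t
    simp [stdSimplexBoundary]
  rw [this]
  exact isClosed_iUnion_of_finite fun i =>
    isClosed_eq (stdSimplex.continuous_eval i) continuous_const

/-- Points are pushed radially from the barycentre: an equal amount is subtracted from every
coordinate and the result is rescaled. The quantity `m` vanishes exactly on the boundary and equals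
1 at the barycentre. -/
theorem isEquivariantNDR_stdSimplexBoundary (G : Type*) (n : ℕ) :
    IsEquivariantNDR (fun (_ : G) (t : stdSimplex ℝ (Fin (n + 1))) => t)
      (stdSimplexBoundary n) := by
  let m : stdSimplex ℝ (Fin (n + 1)) → ℝ := fun t =>
    (n + 1) * Finset.univ.inf' Finset.univ_nonempty fun i => t i
  have hn : (0 : ℝ) < n + 1 := by positivity
  have hm : Continuous m := by
    refine continuous_const.mul ?_
    exact Continuous.finset_inf'_apply _ fun i _ => stdSimplex.continuous_eval i
  have hmt : ∀ t i, m t ≤ (n + 1) * t i := fun t i =>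
    mul_le_mul_of_nonneg_left (Finset.inf'_le _ (Finset.mem_univ i)) hn.le
  have hm0 : ∀ t, 0 ≤ m t := fun t =>
    mul_nonneg hn.le ((Finset.le_inf'_iff _ _).2 fun i _ => stdSimplex.zero_le t i)
  have hmex : ∀ t, ∃ i, m t = (n + 1) * t i := fun t => by
    obtain ⟨i, -, hi⟩ := Finset.exists_mem_eq_inf' (s := Finset.univ) Finset.univ_nonempty
      fun i => t i
    exact ⟨i, by simp only [m, hi]⟩
  have hm_zero : ∀ t ∈ stdSimplexBoundary n, m t = 0 := by
    rintro t ⟨i, hi⟩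
    refine le_antisymm ?_ (hm0 t)
    have := hmt t i
    rwa [hi, mul_zero] at this
  -- Halving the time keeps `s ≤ 1/2`, so the rescaling by `1 - s` is defined even at the
  -- barycentre. The factor 2 in the function `min 1 (2 * m t)` compensates.
  let s : stdSimplex ℝ (Fin (n + 1)) × I → ℝ := fun p => min (p.2 / 2 : ℝ) (m p.1)
  have hs : Continuous s := by fun_prop
  have hs0 : ∀ p, 0 ≤ s p := fun p => le_min (by have := p.2.2.1; positivity) (hm0 _)
  have hs1 : ∀ p, s p ≤ 1 / 2 := fun p =>
    (min_le_left _ _).trans (by have := p.2.2.2; linarith)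
  have hs2 : ∀ p, 0 < 1 - s p := fun p => by have := hs1 p; linarith
  let ψ : stdSimplex ℝ (Fin (n + 1)) × I → stdSimplex ℝ (Fin (n + 1)) := fun p =>
    ⟨fun i => (p.1 i - s p / (n + 1)) / (1 - s p), by
      constructor
      · intro i
        refine div_nonneg (sub_nonneg.2 ?_) (hs2 p).le
        rw [div_le_iff₀' hn]
        exact (min_le_right _ _).trans (hmt _ _)
      · rw [← Finset.sum_div, Finset.sum_sub_distrib, Finset.sum_const, stdSimplex.sum_eq_one]
        simp only [Finset.card_univ, Fintype.card_fin, nsmul_eq_mul]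
        push_cast
        rw [mul_div_cancel₀ _ hn.ne', div_self (hs2 p).ne']⟩
  have hψ : ∀ p i, ψ p i = (p.1 i - s p / (n + 1)) / (1 - s p) := fun _ _ => rfl
  have hψ0 : ∀ p, s p = 0 → ψ p = p.1 := fun p hp => by
    refine stdSimplex.ext (funext fun i => ?_)
    rw [hψ, hp]
    simp
  refine ⟨fun t => ⟨min 1 (2 * m t), le_min zero_le_one (by have := hm0 t; positivity),
    min_le_left _ _⟩, ψ, isClosed_stdSimplexBoundary n, ?_, ?_, fun _ _ => rfl, fun _ _ _ => rfl,
    ?_, ?_, ?_, ?_⟩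
  · exact (by fun_prop : Continuous fun t => min 1 (2 * m t)).subtype_mk _
  · refine Continuous.subtype_mk (continuous_pi fun i => ?_) _
    refine Continuous.div ?_ (by fun_prop) fun p => (hs2 p).ne'
    exact ((stdSimplex.continuous_eval i).comp continuous_fst).sub (hs.div_const _)
  · intro t
    refine hψ0 _ ?_
    change min (0 / 2 : ℝ) (m t) = 0
    rw [zero_div, min_eq_left (hm0 t)]
  · intro t ht
    refine Subtype.ext ?_
    change min 1 (2 * m t) = 0
    rw [hm_zero t ht, mul_zero]
    exact min_eq_right zero_le_one
  · intro t ht r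
    refine hψ0 _ ?_
    change min (r / 2 : ℝ) (m t) = 0
    rw [hm_zero t ht]
    exact min_eq_right (by have := r.2.1; positivity)
  · intro t r hr
    have h1 : min 1 (2 * m t) < r := hr
    have h2 : 2 * m t < r := by
      rcases min_lt_iff.1 h1 with h | h
      · exact absurd r.2.2 (not_le.2 h)
      · exact h
    have h3 : s (t, r) = m t := min_eq_right (by change m t ≤ r / 2; linarith)
    obtain ⟨i, hi⟩ := hmex t
    refine ⟨i, ?_⟩
    rw [hψ, h3, hi, mul_div_cancel_left₀ _ hn.ne', sub_self, zero_div]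

/-! ### Lillig's union theorem -/

/-- Sliding along a compact parameter space by a parameter function which may be discontinuous at
points where the sliding has no effect. -/
theorem continuousAt_of_forall_eq {B K T Z : Type*} [TopologicalSpace B] [TopologicalSpace K]
    [CompactSpace K] [TopologicalSpace T] [TopologicalSpace Z] {Ψ : (B × K) × T → Z}
    (hΨ : Continuous Ψ) (sl : B → K) (b : B) (t : T)
    (h : ∀ k, Ψ ((b, k), t) = Ψ ((b, sl b), t)) :
    ContinuousAt (fun p : B × T => Ψ ((p.1, sl p.1), p.2)) (b, t) := by
  intro V hV
  have h1 : ∀ᶠ p : B × T in 𝓝 (b, t), ∀ k ∈ (Set.univ : Set K), Ψ ((p.1, k), p.2) ∈ V := by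
    refine isCompact_univ.eventually_forall_of_forall_eventually fun k _ => ?_
    have h2 : Continuous fun q : (B × T) × K => Ψ ((q.1.1, q.2), q.1.2) := by fun_prop
    refine h2.continuousAt.eventually_mem ?_
    change V ∈ 𝓝 (Ψ ((b, k), t))
    rw [h k]
    exact hV
  exact h1.mono fun p hp => hp _ trivial

namespace IsEquivariantNDR

variable {G B : Type*} [TopologicalSpace B] {act : G → B → B} {A A₁ A₂ : Set B}

/-- This is the universal extension problem, with target `B × I` and `H` the identity. -/
theorem exists_relative_retraction (h : IsEquivariantNDR act A) :
    ∃ R : B × I → B × I, Continuous R ∧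
      (∀ g b t, R (act g b, t) = (act g (R (b, t)).1, (R (b, t)).2)) ∧
      (∀ b, R (b, 0) = (b, 0)) ∧ (∀ a ∈ A, ∀ t, R (a, t) = (a, t)) ∧
      ∀ p, (R p).2 = 0 ∨ (R p).1 ∈ A := by
  obtain ⟨v, φ, h⟩ := h
  obtain ⟨R, hR, hact, h0, hA, hmem⟩ := h.exists_extension
    (fun g p => (act g p.1, p.2)) (f := fun b => (b, (0 : I))) (H := id)
    (by fun_prop) continuousOn_id (fun _ _ => rfl) (fun _ _ _ _ => rfl) (fun _ _ => rfl)
  refine ⟨R, hR, hact, h0, hA, fun p => ?_⟩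
  rcases hmem p.1 p.2 with ⟨b, hb⟩ | ⟨a, ha, t, hat⟩
  · exact Or.inl (congrArg Prod.snd hb)
  · right
    rw [show R p = (a, t) from hat]
    exact ha

/-- Lillig's union theorem. -/
theorem union (h₁ : IsEquivariantNDR act A₁) (h₂ : IsEquivariantNDR act A₂)
    (h₁₂ : IsEquivariantNDR act (A₁ ∩ A₂)) : IsEquivariantNDR act (A₁ ∪ A₂) := by
  classical
  obtain ⟨R₁, hR₁, hact₁, h0₁, hA₁, hmem₁⟩ := h₁.exists_relative_retraction
  obtain ⟨R₂, hR₂, hact₂, h0₂, hA₂, hmem₂⟩ := h₂.exists_relative_retraction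
  obtain ⟨v, φ, h⟩ := h₁₂
  obtain ⟨w, ψ, hK⟩ := isEquivariantNDR_stdSimplexBoundary G 1
  obtain ⟨v₁, φ₁, h₁⟩ := h₁
  obtain ⟨v₂, φ₂, h₂⟩ := h₂
  let K := stdSimplex ℝ (Fin 2)
  let actZ : G → B × I → B × I := fun g p => (act g p.1, p.2)
  -- The two retractions sit at the two ends of a 1-simplex of parameters, and everything is
  -- stationary over `A₁ ∩ A₂`. The product Strøm structure extends this over all parameters.
  let H : (B × K) × I → B × I := fun p =>
    if p.1.2 1 = 0 then R₁ (p.1.1, p.2) else if p.1.2 0 = 0 then R₂ (p.1.1, p.2) else (p.1.1, p.2)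
  have hK01 : ∀ k : K, k 1 = 0 → k 0 ≠ 0 := fun k h1 h0 => by
    have := stdSimplex.add_eq_one k
    rw [h0, h1, add_zero] at this
    exact zero_ne_one this
  have H1 : ∀ b (k : K) t, k 1 = 0 → H ((b, k), t) = R₁ (b, t) := fun b k t hk => if_pos hk
  have H2 : ∀ b (k : K) t, k 0 = 0 → H ((b, k), t) = R₂ (b, t) := fun b k t hk =>
    (if_neg fun h => hK01 k h hk).trans (if_pos hk)
  have H3 : ∀ b (k : K) t, b ∈ A₁ ∩ A₂ → H ((b, k), t) = (b, t) := fun b k t hb => by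
    by_cases h1 : k 1 = 0
    · rw [H1 _ _ _ h1, hA₁ b hb.1]
    · by_cases h2 : k 0 = 0
      · rw [H2 _ _ _ h2, hA₂ b hb.2]
      · exact (if_neg h1).trans (if_neg h2)
  have e0 : Continuous fun p : (B × K) × I => p.1.2 0 :=
    (stdSimplex.continuous_eval (0 : Fin 2)).comp (continuous_snd.comp continuous_fst)
  have e1 : Continuous fun p : (B × K) × I => p.1.2 1 :=
    (stdSimplex.continuous_eval (1 : Fin 2)).comp (continuous_snd.comp continuous_fst)
  have hH : ContinuousOn H ({p | p.1 ∈ A₁ ∩ A₂ ∨ p.2 ∈ stdSimplexBoundary 1} ×ˢ Set.univ) := by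
    have c1 : ContinuousOn H {p | p.1.2 1 = 0} :=
      (show Continuous fun p : (B × K) × I => R₁ (p.1.1, p.2) by fun_prop).continuousOn.congr
        fun p hp => H1 _ _ _ hp
    have c2 : ContinuousOn H {p | p.1.2 0 = 0} :=
      (show Continuous fun p : (B × K) × I => R₂ (p.1.1, p.2) by fun_prop).continuousOn.congr
        fun p hp => H2 _ _ _ hp
    have c3 : ContinuousOn H {p | p.1.1 ∈ A₁ ∩ A₂} :=
      (show Continuous fun p : (B × K) × I => (p.1.1, p.2) by fun_prop).continuousOn.congr
        fun p hp => H3 _ _ _ hp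
    have k1 : IsClosed {p : (B × K) × I | p.1.2 1 = 0} := isClosed_eq e1 continuous_const
    have k2 : IsClosed {p : (B × K) × I | p.1.2 0 = 0} := isClosed_eq e0 continuous_const
    have k3 : IsClosed {p : (B × K) × I | p.1.1 ∈ A₁ ∩ A₂} :=
      h.isClosed.preimage (continuous_fst.comp continuous_fst)
    refine (c3.union_of_isClosed (c1.union_of_isClosed c2 k1 k2) k3 (k1.union k2)).mono ?_
    rintro p ⟨h1 | ⟨i, hi⟩, -⟩
    · exact Or.inl h1
    · right
      fin_cases i
      · exact Or.inr hi
      · exact Or.inl hi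
  obtain ⟨Ψ, hΨ, hΨact, hΨ0, hΨH, hΨmem⟩ := (h.prod hK).exists_extension actZ
    (f := fun p => (p.1, (0 : I))) (H := H) (by fun_prop) hH (fun _ _ => rfl) (by
      rintro g ⟨a, k⟩ - t
      change H ((act g a, k), t) = actZ g (H ((a, k), t))
      simp only [H, hact₁, hact₂, actZ]
      split_ifs <;> rfl) (by
      rintro ⟨a, k⟩ -
      simp only [H, h0₁, h0₂, ite_self])
  have hsum : ∀ b, b ∉ A₁ ∩ A₂ → 0 < (v₁ b + v₂ b : ℝ) := fun b hb => by
    have p1 := (v₁ b).2.1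
    have p2 := (v₂ b).2.1
    refine lt_of_le_of_ne (by positivity) fun h0 => hb ⟨?_, ?_⟩
    · exact (h₁.mem_iff b).2 (Subtype.ext (show (v₁ b : ℝ) = 0 by linarith))
    · exact (h₂.mem_iff b).2 (Subtype.ext (show (v₂ b : ℝ) = 0 by linarith))
  -- The slider selects the vertex of `R₁` on `A₁` and that of `R₂` on `A₂`. Its value on `A₁ ∩ A₂`
  -- is arbitrary: there `Ψ` does not depend on the parameter, so the composite stays continuous.
  let sl : B → K := fun b =>
    if hb : b ∈ A₁ ∩ A₂ then ⟨_, single_mem_stdSimplex ℝ 0⟩ else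
      ⟨![v₂ b / (v₁ b + v₂ b), v₁ b / (v₁ b + v₂ b)], by
        have p1 := (v₁ b).2.1
        have p2 := (v₂ b).2.1
        have p3 := hsum b hb
        constructor
        · intro i
          fin_cases i
          · exact div_nonneg p2 p3.le
          · exact div_nonneg p1 p3.le
        · rw [Fin.sum_univ_two]
          change (v₂ b / (v₁ b + v₂ b) + v₁ b / (v₁ b + v₂ b) : ℝ) = 1
          rw [← add_div, add_comm, div_self p3.ne']⟩
  have sl0 : ∀ b, b ∉ A₁ ∩ A₂ → sl b 0 = v₂ b / (v₁ b + v₂ b) := fun b hb => by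
    simp only [sl, dif_neg hb]
    rfl
  have sl1 : ∀ b, b ∉ A₁ ∩ A₂ → sl b 1 = v₁ b / (v₁ b + v₂ b) := fun b hb => by
    simp only [sl, dif_neg hb]
    rfl
  have hA : ∀ b ∈ A₁ ∩ A₂, ∀ k t, Ψ ((b, k), t) = (b, t) := fun b hb k t => by
    rw [hΨH _ (Or.inl hb), H3 _ _ _ hb]
  have hslact : ∀ g b, sl (act g b) = sl b := fun g b => by
    simp only [sl, Set.mem_inter_iff, h₁.mem_iff, h₂.mem_iff, h₁.fun_act, h₂.fun_act]
  refine of_retraction (h₁.isClosed.union h₂.isClosed) (R := fun p => Ψ ((p.1, sl p.1), p.2))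
    ?_ ?_ ?_ ?_ ?_
  · rw [continuous_iff_continuousAt]
    rintro ⟨b, t⟩
    by_cases hb : b ∈ A₁ ∩ A₂
    · exact continuousAt_of_forall_eq hΨ sl b t fun k => by rw [hA b hb, hA b hb]
    · have hopen : (A₁ ∩ A₂)ᶜ ∈ 𝓝 b := h.isClosed.isOpen_compl.mem_nhds hb
      have hsl : ContinuousAt sl b := by
        rw [IsInducing.subtypeVal.continuousAt_iff, continuousAt_pi]
        have c1 : Continuous fun b => (v₁ b : ℝ) :=
          continuous_subtype_val.comp h₁.continuous_fun
        have c2 : Continuous fun b => (v₂ b : ℝ) :=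
          continuous_subtype_val.comp h₂.continuous_fun
        have hne := (hsum b hb).ne'
        intro i
        fin_cases i
        · refine (c2.continuousAt.div (c1.add c2).continuousAt hne).congr ?_
          filter_upwards [hopen] with b' hb' using (sl0 b' hb').symm
        · refine (c1.continuousAt.div (c1.add c2).continuousAt hne).congr ?_
          filter_upwards [hopen] with b' hb' using (sl1 b' hb').symm
      have : ContinuousAt (fun p : B × I => ((p.1, sl p.1), p.2)) (b, t) :=
        (continuousAt_fst.prodMk (hsl.comp_of_eq continuousAt_fst rfl)).prodMk continuousAt_snd
      exact hΨ.continuousAt.comp this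
  · intro g b t
    have := hΨact g (b, sl b) t
    simp only [hslact]
    exact this
  · intro b
    exact hΨ0 _
  · rintro b hb t
    change Ψ ((b, sl b), t) = (b, t)
    by_cases hb' : b ∈ A₁ ∩ A₂
    · exact hA b hb' _ _
    · rcases hb with hb | hb
      · have h1 : sl b 1 = 0 := by
          rw [sl1 b hb', h₁.fun_eq_zero b hb]
          exact zero_div _
        rw [hΨH _ (Or.inr ⟨1, h1⟩), H1 _ _ _ h1, hA₁ b hb]
      · have h1 : sl b 0 = 0 := by
          rw [sl0 b hb', h₂.fun_eq_zero b hb]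
          exact zero_div _
        rw [hΨH _ (Or.inr ⟨0, h1⟩), H2 _ _ _ h1, hA₂ b hb]
  · rintro ⟨b, t⟩
    rcases hΨmem (b, sl b) t with ⟨b', hb'⟩ | ⟨⟨a, k⟩, ha, t', hat⟩
    · exact Or.inl (congrArg Prod.snd hb')
    · change (Ψ ((b, sl b), t)).2 = 0 ∨ (Ψ ((b, sl b), t)).1 ∈ A₁ ∪ A₂
      rw [hat]
      by_cases h1 : k 1 = 0
      · rw [H1 _ _ _ h1]
        exact (hmem₁ _).imp_right Or.inl
      · by_cases h2 : k 0 = 0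
        · rw [H2 _ _ _ h2]
          exact (hmem₂ _).imp_right Or.inr
        · have : a ∈ A₁ ∩ A₂ := ha.resolve_right fun ⟨i, hi⟩ => by
            fin_cases i
            · exact h2 hi
            · exact h1 hi
          rw [H3 _ _ _ this]
          exact Or.inr (Or.inl this.1)

end IsEquivariantNDR

/-! ### The mapping cylinder as a G-space -/

section MappingCylinder

variable {A B : Type u} (i : A → B)

open Classical in
/-- The normal form of a representative of a point of the mapping cylinder of `i`. -/
noncomputable def mappingCylinderNormalForm : B ⊕ A × I → B ⊕ A × I
  | Sum.inl b => Sum.inl b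
  | Sum.inr p => if p.2 = 0 then Sum.inl (i p.1) else Sum.inr p

/-- The mapping cylinder of `i : A → B`, in which `(a, 0)` is identified with `i a`. -/
def MappingCylinder : Type u := Quotient (Setoid.ker (mappingCylinderNormalForm i))

namespace MappingCylinder

/-- The inclusion of the base. -/
noncomputable def base (b : B) : MappingCylinder i := Quotient.mk _ (Sum.inl b)

/-- The canonical map from the cylinder. -/
noncomputable def cyl (p : A × I) : MappingCylinder i := Quotient.mk _ (Sum.inr p)

/-- Since the equivalence relation is the kernel of the normal form, equality of classes is equality
of normal forms and no generated relation has to be unwound. -/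
theorem base_eq_base {b b' : B} : base i b = base i b' ↔ b = b' := by
  refine (Quotient.eq (r := Setoid.ker _)).trans ?_
  rw [Setoid.ker_def]
  simp [mappingCylinderNormalForm]

theorem cyl_eq_base {p : A × I} {b : B} : cyl i p = base i b ↔ p.2 = 0 ∧ i p.1 = b := by
  refine (Quotient.eq (r := Setoid.ker _)).trans ?_
  rw [Setoid.ker_def]
  by_cases h : p.2 = 0 <;> simp [mappingCylinderNormalForm, h]

theorem cyl_eq_cyl {p q : A × I} :
    cyl i p = cyl i q ↔ (p.1 = q.1 ∧ p.2 = q.2) ∨ (p.2 = 0 ∧ q.2 = 0 ∧ i p.1 = i q.1) := by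
  refine (Quotient.eq (r := Setoid.ker _)).trans ?_
  rw [Setoid.ker_def, ← Prod.ext_iff]
  by_cases h : p.2 = 0 <;> by_cases h' : q.2 = 0 <;> simp [mappingCylinderNormalForm, h, h']
  · rintro rfl
    rfl
  · rintro rfl
    exact h' h
  · rintro rfl
    exact h h'

variable {i} in
theorem ind {P : MappingCylinder i → Prop} (hb : ∀ b, P (base i b)) (hc : ∀ p, P (cyl i p))
    (x : MappingCylinder i) : P x := by
  induction x using Quotient.ind with
  | _ x => exact x.rec hb hc

/-- The map out of the mapping cylinder given by compatible maps. -/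
noncomputable def desc {Z : Type*} (f : B → Z) (H : A × I → Z) (h : ∀ a, H (a, 0) = f (i a)) :
    MappingCylinder i → Z :=
  Quotient.lift (Sum.elim f H) (by
    have key : ∀ x, Sum.elim f H (mappingCylinderNormalForm i x) = Sum.elim f H x := by
      rintro (b | ⟨a, t⟩)
      · rfl
      · by_cases ht : t = 0
        · simp [mappingCylinderNormalForm, ht, h]
        · simp [mappingCylinderNormalForm, ht]
    intro x y hxy
    rw [← key x, ← key y, show mappingCylinderNormalForm i x = _ from hxy])

variable [TopologicalSpace A] [TopologicalSpace B]

instance : TopologicalSpace (MappingCylinder i) :=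
  inferInstanceAs (TopologicalSpace (Quotient _))

theorem continuous_base : Continuous (base i) :=
  continuous_quotient_mk'.comp continuous_inl

theorem continuous_cyl : Continuous (cyl i) :=
  continuous_quotient_mk'.comp continuous_inr

theorem isClosed_iff (C : Set (MappingCylinder i)) :
    IsClosed C ↔ IsClosed (base i ⁻¹' C) ∧ IsClosed (cyl i ⁻¹' C) := by
  refine (isQuotientMap_quotient_mk'
    (s := Setoid.ker (mappingCylinderNormalForm i))).isClosed_preimage.symm.trans ?_
  rw [isClosed_sum_iff]
  rfl

theorem continuous_desc {Z : Type*} [TopologicalSpace Z] {f : B → Z} {H : A × I → Z}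
    (h : ∀ a, H (a, 0) = f (i a)) (hf : Continuous f) (hH : Continuous H) :
    Continuous (desc i f H h) :=
  Continuous.quotient_lift (hf.sumElim hH) _

variable {G : Type u} [Group G] [MulAction G A] [MulAction G B]

/-- The action on the mapping cylinder of an equivariant map. -/
noncomputable abbrev mulAction {i : A → B} (hi : ∀ (g : G) (a : A), i (g • a) = g • i a) :
    MulAction G (MappingCylinder i) where
  smul g := desc i (fun b => base i (g • b)) (fun p => cyl i (g • p.1, p.2))
    fun a => (cyl_eq_base i).2 ⟨rfl, hi g a⟩
  one_smul := ind (fun b => congrArg (base i) (one_smul G b))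
    fun p => congrArg (fun a => cyl i (a, p.2)) (one_smul G p.1)
  mul_smul g g' := ind (fun b => congrArg (base i) (mul_smul g g' b))
    fun p => congrArg (fun a => cyl i (a, p.2)) (mul_smul g g' p.1)

/-- The homotopy extension property concerns only targets that are `G`-spaces, so the cylinder must
be shown to be one before it can serve as a test object. -/
theorem isGSpace [TopologicalSpace G] (hA : IsGSpace G A) (hB : IsGSpace G B) {i : A → B}
    (hi : ∀ (g : G) (a : A), i (g • a) = g • i a) (hic : Continuous i) :
    letI := mulAction hi
    IsGSpace G (MappingCylinder i) := by
  let := mulAction hi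
  let T : ∀ S : CompHaus.{u}, (S → MappingCylinder i) → Prop := fun S c =>
    (∃ b : S → B, Continuous b ∧ c = base i ∘ b) ∨
      ∃ a : S → A × I, Continuous a ∧ c = cyl i ∘ a
  have hT : IsGenerating T := by
    refine ⟨?_, ?_, ?_⟩
    · rintro S c (⟨b, hb, rfl⟩ | ⟨a, ha, rfl⟩)
      · exact (continuous_base i).comp hb
      · exact (continuous_cyl i).comp ha
    · intro y
      refine ⟨CompHaus.of PUnit, fun _ => y, ?_, ⟨⟨⟩, rfl⟩⟩
      induction y using ind with
      | hb b => exact Or.inl ⟨fun _ => b, continuous_const, rfl⟩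
      | hc p => exact Or.inr ⟨fun _ => p, continuous_const, rfl⟩
    · intro C hC
      rw [isClosed_iff]
      refine ⟨hB.isGenerating.isClosed _ fun S c hc => hC S _ (Or.inl ⟨c, hc, rfl⟩),
        hA.isGenerating.isClosed_prod _ fun S c hc => ?_⟩
      exact hC (CompHaus.of (S × I)) (fun p => cyl i (c p.1, p.2))
        (Or.inr ⟨fun p => (c p.1, p.2), by fun_prop, rfl⟩)
  have key : ∀ (S S' : CompHaus.{u}) (a : S → A × I) (b : S' → B), Continuous a → Continuous b →
      IsClosed {p : S × S' | cyl i (a p.1) = base i (b p.2)} := fun S S' a b ha hb => by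
    simp only [cyl_eq_base]
    exact (isClosed_eq (by fun_prop) continuous_const).inter
      (hB.weakHausdorff.isClosed_eq (K := S × S') (by fun_prop) (by fun_prop))
  refine hT.isGSpace ?_ ?_
  · rintro S S' c c' (⟨b, hb, rfl⟩ | ⟨a, ha, rfl⟩) (⟨b', hb', rfl⟩ | ⟨a', ha', rfl⟩)
    · simp only [Function.comp, base_eq_base]
      exact hB.weakHausdorff.isClosed_eq (K := S × S') (by fun_prop) (by fun_prop)
    · convert (key S' S a' b ha' hb).preimage continuous_swap using 1
      ext p
      exact eq_comm
    · exact key S S' a b' ha hb'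
    · simp only [Function.comp, cyl_eq_cyl]
      refine IsClosed.union (IsClosed.inter ?_ ?_) (IsClosed.inter ?_ (IsClosed.inter ?_ ?_))
      · exact hA.weakHausdorff.isClosed_eq (K := S × S') (by fun_prop) (by fun_prop)
      · exact isClosed_eq (by fun_prop) (by fun_prop)
      · exact isClosed_eq (by fun_prop) (by fun_prop)
      · exact isClosed_eq (by fun_prop) (by fun_prop)
      · exact hB.weakHausdorff.isClosed_eq (K := S × S') (by fun_prop) (by fun_prop)
  · rintro S K c g (⟨b, hb, rfl⟩ | ⟨a, ha, rfl⟩) hg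
    · refine (continuous_base i).comp (hB.continuous_smul_of_compact (K := S × K)
        (g := fun p => g p.2) (x := fun p => b p.1) (by fun_prop) (by fun_prop))
    · refine (continuous_cyl i).comp (Continuous.prodMk (hA.continuous_smul_of_compact (K := S × K)
        (g := fun p => g p.2) (x := fun p => (a p.1).1) (by fun_prop) (by fun_prop)) ?_)
      fun_prop

end MappingCylinder

end MappingCylinder

/-! ### Cofibrations as closed embeddings and NDRs -/

namespace IsGCofibration

variable {G : Type u} [Group G] [TopologicalSpace G] {A B C : Type u} [TopologicalSpace A]
  [TopologicalSpace B] [TopologicalSpace C] [MulAction G A] [MulAction G B] [MulAction G C]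

theorem comp {i : A → B} {j : B → C} (hj : IsGCofibration G j) (hi : IsGCofibration G i) :
    IsGCofibration G (j ∘ i) where
  continuous := hj.continuous.comp hi.continuous
  map_smul g a := by simp only [Function.comp, hi.map_smul, hj.map_smul]
  homotopy_extension Z _ _ hZ h H hh hhG hH hHG h0 := by
    obtain ⟨H₁, c₁, g₁, z₁, e₁⟩ := hi.homotopy_extension Z hZ (h ∘ j) H (hh.comp hj.continuous)
      (fun g b => by simp only [Function.comp, hj.map_smul, hhG]) hH hHG h0
    obtain ⟨H₂, c₂, g₂, z₂, e₂⟩ := hj.homotopy_extension Z hZ h H₁ hh hhG c₁ g₁ z₁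
    exact ⟨H₂, c₂, g₂, z₂, fun a t => (e₂ _ t).trans (e₁ a t)⟩

open MappingCylinder in
theorem exists_cylinder_retraction {i : A → B} (hi : IsGCofibration G i) (hA : IsGSpace G A)
    (hB : IsGSpace G B) : letI := mulAction hi.map_smul
    ∃ r : B × I → MappingCylinder i, Continuous r ∧
      (∀ (g : G) b t, r (g • b, t) = g • r (b, t)) ∧ (∀ b, r (b, 0) = base i b) ∧
      ∀ a t, r (i a, t) = cyl i (a, t) :=
  letI := mulAction hi.map_smul
  hi.homotopy_extension _ (MappingCylinder.isGSpace hA hB hi.map_smul hi.continuous) (base i)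
    (cyl i) (continuous_base i) (fun _ _ => rfl) (continuous_cyl i) (fun _ _ _ => rfl)
    fun _ => (cyl_eq_base i).2 ⟨rfl, rfl⟩

-- At time 1 the cylinder remembers the point of `A`, whence injectivity. The image of a closed `C`
-- is cut out by two closed conditions on `b`: `r (b, 1)` lies in the copy of `C` at the free end,
-- and it projects back to `b`.
open MappingCylinder in
theorem isClosedEmbedding {i : A → B} (hi : IsGCofibration G i) (hA : IsGSpace G A)
    (hB : IsGSpace G B) : IsClosedEmbedding i := by
  obtain ⟨r, hr, -, hr0, hri⟩ := hi.exists_cylinder_retraction hA hB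
  let j : MappingCylinder i → B × I :=
    desc i (fun b => (b, 0)) (fun p => (i p.1, p.2)) fun _ => rfl
  have hj : Continuous j := continuous_desc i _ (by fun_prop) (by
    have := hi.continuous
    fun_prop)
  have hinj : Function.Injective i := fun a a' h => by
    have h1 := (hri a 1).symm.trans ((congrArg (fun b => r (b, 1)) h).trans (hri a' 1))
    rcases (cyl_eq_cyl i).1 h1 with h2 | h2
    · exact h2.1
    · exact absurd h2.1 one_ne_zero
  refine IsClosedEmbedding.of_continuous_injective_isClosedMap hi.continuous hinj fun C hC => ?_
  have h1 : IsClosed (cyl i '' (C ×ˢ {1})) := by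
    rw [isClosed_iff]
    constructor
    · convert isClosed_empty
      rw [Set.eq_empty_iff_forall_notMem]
      rintro b ⟨⟨a, t⟩, ⟨-, ht⟩, h⟩
      rw [cyl_eq_base, show t = 1 from ht] at h
      exact one_ne_zero h.1
    · convert hC.prod (isClosed_singleton (x := (1 : I))) using 1
      ext p
      constructor
      · rintro ⟨q, hq, h⟩
        rcases (cyl_eq_cyl i).1 h with h2 | h2
        · rwa [← Prod.ext h2.1 h2.2]
        · exact absurd (h2.1.symm.trans hq.2) zero_ne_one
      · exact fun hp => ⟨p, hp, rfl⟩
  have h2 : IsClosed {b : B | (j (r (b, 1))).1 = b} :=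
    hB.isClosed_eq hB.compactlyGenerated (by fun_prop) continuous_id
  convert h2.inter (h1.preimage (hr.comp (Continuous.prodMk_left (1 : I)))) using 1
  ext b
  constructor
  · rintro ⟨a, ha, rfl⟩
    refine ⟨?_, ⟨(a, 1), ⟨ha, rfl⟩, (hri a 1).symm⟩⟩
    change (j (r (i a, 1))).1 = i a
    rw [hri]
    rfl
  · rintro ⟨h3, ⟨⟨a, t⟩, ⟨ha, ht⟩, h4⟩⟩
    refine ⟨a, ha, ?_⟩
    change (j (r (b, 1))).1 = b at h3
    change cyl i (a, t) = r (b, 1) at h4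
    rw [← h3, ← h4]
    rfl

-- Following the cylinder retraction by the canonical map to `B × I` gives the retraction required
-- by `of_retraction`.
open MappingCylinder in
theorem isEquivariantNDR {i : A → B} (hi : IsGCofibration G i) (hA : IsGSpace G A)
    (hB : IsGSpace G B) : IsEquivariantNDR (fun (g : G) (b : B) => g • b) (Set.range i) := by
  obtain ⟨r, hr, hrG, hr0, hri⟩ := hi.exists_cylinder_retraction hA hB
  let j : MappingCylinder i → B × I :=
    desc i (fun b => (b, 0)) (fun p => (i p.1, p.2)) fun _ => rfl
  have hj : Continuous j := continuous_desc i _ (by fun_prop) (by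
    have := hi.continuous
    fun_prop)
  have hjG : letI := mulAction hi.map_smul
      ∀ (g : G) x, j (g • x) = (g • (j x).1, (j x).2) := fun g =>
    ind (fun _ => rfl) fun p => Prod.ext (hi.map_smul g p.1) rfl
  have hjm : ∀ x, (j x).2 = 0 ∨ (j x).1 ∈ Set.range i :=
    ind (fun _ => Or.inl rfl) fun p => Or.inr ⟨p.1, rfl⟩
  refine IsEquivariantNDR.of_retraction (hi.isClosedEmbedding hA hB).isClosed_range
    (R := fun p => j (r p)) (hj.comp hr) ?_ ?_ ?_ fun _ => hjm _
  · intro g b t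
    simp only [hrG, hjG]
  · intro b
    simp only [hr0]
    rfl
  · rintro _ ⟨a, rfl⟩ t
    simp only [hri]
    rfl

end IsGCofibration

/-! ### Common refinements of points of simplices -/

section Coupling

/-- The partial sums of a finite sequence. -/
def partialSum {n : ℕ} (u : Fin n → ℝ) (k : ℕ) : ℝ := ∑ i with i.val < k, u i

theorem partialSum_zero {n : ℕ} (u : Fin n → ℝ) : partialSum u 0 = 0 := by
  simp [partialSum]

theorem partialSum_self {n : ℕ} (u : Fin n → ℝ) : partialSum u n = ∑ i, u i := by
  simp [partialSum]

theorem partialSum_succ {n : ℕ} (u : Fin n → ℝ) (i : Fin n) :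
    partialSum u (i + 1) = partialSum u i + u i := by
  have : Finset.univ.filter (fun j : Fin n => j.val < i + 1) =
      insert i (Finset.univ.filter fun j : Fin n => j.val < i) := by
    ext j
    simp only [Finset.mem_filter_univ, Finset.mem_insert, Fin.ext_iff]
    omega
  rw [partialSum, this, Finset.sum_insert (by simp), add_comm, partialSum]

theorem partialSum_mono {n : ℕ} {u : Fin n → ℝ} (hu : ∀ i, 0 ≤ u i) : Monotone (partialSum u) :=
  fun _ _ hkl => Finset.sum_le_sum_of_subset_of_nonneg
    (Finset.monotone_filter_right _ fun _ _ h => lt_of_lt_of_le h hkl) fun i _ _ => hu i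

/-- The length of the overlap of the intervals `[a, b]` and `[c, d]`. -/
def overlap (a b c d : ℝ) : ℝ := max 0 (min b d - max a c)

theorem overlap_comm (a b c d : ℝ) : overlap a b c d = overlap c d a b := by
  rw [overlap, overlap, min_comm, max_comm a c]

theorem overlap_nonneg (a b c d : ℝ) : 0 ≤ overlap a b c d := le_max_left _ _

theorem lt_of_overlap_ne_zero {a b c d : ℝ} (h : overlap a b c d ≠ 0) : a < d ∧ c < b := by
  by_contra hcon
  refine h (max_eq_left ?_)
  rcases not_and_or.1 hcon with h1 | h1
  · linarith [min_le_right b d, le_max_left a c]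
  · linarith [min_le_left b d, le_max_right a c]

theorem overlap_eq_sub {a b c d : ℝ} (hab : a ≤ b) (hcd : c ≤ d) :
    overlap a b c d = max a (min b d) - max a (min b c) := by
  simp only [overlap, max_def, min_def]
  split_ifs <;> linarith

/-- Written with clamped endpoints as in `overlap_eq_sub`, the sum telescopes. -/
theorem sum_overlap {n : ℕ} {v : Fin n → ℝ} (hv : ∀ i, 0 ≤ v i) {a b : ℝ} (ha : 0 ≤ a)
    (hab : a ≤ b) (hb : b ≤ ∑ i, v i) :
    ∑ j : Fin n, overlap a b (partialSum v j) (partialSum v (j + 1)) = b - a := by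
  rw [Fin.sum_univ_eq_sum_range
    (fun j => overlap a b (partialSum v j) (partialSum v (j + 1))) n]
  rw [Finset.sum_congr rfl fun j _ => overlap_eq_sub hab (partialSum_mono hv (Nat.le_succ j)),
    Finset.sum_range_sub (fun j => max a (min b (partialSum v j))), partialSum_zero,
    partialSum_self, min_eq_left hb, max_eq_right hab, min_eq_right (ha.trans hab),
    max_eq_left ha]

/-- The mass of `u` up to `i` is at most its mass over `M`-values at most `β i`. Fibrewise, `v` has
the same mass there, carried by indices strictly before `j`. -/
theorem partialSum_le_of_fiberwise {n m : ℕ} {M : Type*} [LinearOrder M] {u : Fin n → ℝ}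
    {v : Fin m → ℝ} (hu : ∀ i, 0 ≤ u i) (hv : ∀ j, 0 ≤ v j) {β : Fin n → M} {γ : Fin m → M}
    (hβ : Monotone β) (hγ : Monotone γ) (h : ∀ x, ∑ i with β i = x, u i = ∑ j with γ j = x, v j)
    {i : Fin n} {j : Fin m} (hij : β i < γ j) : partialSum u (i + 1) ≤ partialSum v j := by
  calc partialSum u (i + 1) ≤ ∑ k with β k ≤ β i, u k :=
        Finset.sum_le_sum_of_subset_of_nonneg
          (Finset.monotone_filter_right _ fun k _ hk => hβ (Fin.le_def.2 (Nat.lt_succ_iff.1 hk)))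
          fun i _ _ => hu i
    _ = ∑ k with γ k ≤ β i, v k := by
        let S : Finset M := (Finset.univ.image β ∪ Finset.univ.image γ).filter (· ≤ β i)
        have h1 : ∑ k with β k ≤ β i, u k = ∑ x ∈ S, ∑ k with β k = x, u k := by
          rw [← Finset.sum_fiberwise_of_maps_to (s := Finset.univ.filter fun k => β k ≤ β i)
            (t := S) (g := β) (by
              intro k hk
              simp only [Finset.mem_filter_univ] at hk
              simp [S, hk])]
          refine Finset.sum_congr rfl fun x hx => Finset.sum_congr ?_ fun _ _ => rfl
          ext k
          simp only [Finset.mem_filter, Finset.mem_univ, true_and, and_iff_right_iff_imp]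
          rintro rfl
          exact (Finset.mem_filter.1 hx).2
        have h2 : ∑ k with γ k ≤ β i, v k = ∑ x ∈ S, ∑ k with γ k = x, v k := by
          rw [← Finset.sum_fiberwise_of_maps_to (s := Finset.univ.filter fun k => γ k ≤ β i)
            (t := S) (g := γ) (by
              intro k hk
              simp only [Finset.mem_filter_univ] at hk
              simp [S, hk])]
          refine Finset.sum_congr rfl fun x hx => Finset.sum_congr ?_ fun _ _ => rfl
          ext k
          simp only [Finset.mem_filter, Finset.mem_univ, true_and, and_iff_right_iff_imp]
          rintro rfl
          exact (Finset.mem_filter.1 hx).2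
        rw [h1, h2]
        exact Finset.sum_congr rfl fun x _ => h x
    _ ≤ partialSum v j :=
        Finset.sum_le_sum_of_subset_of_nonneg
          (Finset.monotone_filter_right _ fun k _ hk => by
            by_contra hkj
            exact absurd (hγ (Fin.le_def.2 (not_lt.1 hkj))) (not_le.2 (lt_of_le_of_lt hk hij)))
          fun i _ _ => hv i

theorem stdSimplex.map_apply_eq_sum {ι κ : Type*} [Fintype ι] [Fintype κ] [DecidableEq κ]
    (f : ι → κ) (t : stdSimplex ℝ ι) (x : κ) : stdSimplex.map f t x = ∑ i with f i = x, t i := by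
  rw [stdSimplex.map_coe, FunOnFinite.linearMap_apply_apply]

/-- Two points of simplices with the same image under monotone maps have a common refinement. -/
theorem exists_common_refinement {r s m : ℕ} (u : stdSimplex ℝ (Fin (r + 1)))
    (v : stdSimplex ℝ (Fin (s + 1))) (β : Fin (r + 1) →o Fin (m + 1))
    (γ : Fin (s + 1) →o Fin (m + 1)) (h : stdSimplex.map β u = stdSimplex.map γ v) :
    ∃ (q : ℕ) (w : stdSimplex ℝ (Fin (q + 1))) (p : Fin (q + 1) →o Fin (r + 1))
      (p' : Fin (q + 1) →o Fin (s + 1)),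
      stdSimplex.map p w = u ∧ stdSimplex.map p' w = v ∧ β.comp p = γ.comp p' := by
  classical
  have hu := stdSimplex.zero_le u
  have hv := stdSimplex.zero_le v
  have hβγ : ∀ x, ∑ i with β i = x, u i = ∑ j with γ j = x, v j := fun x => by
    rw [← stdSimplex.map_apply_eq_sum, ← stdSimplex.map_apply_eq_sum, h]
  -- The unit interval is cut into consecutive pieces of lengths `u i`, and again into pieces of
  -- lengths `v j`. The overlaps are a coupling whose marginals are `u` and `v`.
  let W : Fin (r + 1) → Fin (s + 1) → ℝ := fun i j =>
    overlap (partialSum u i) (partialSum u (i + 1)) (partialSum v j) (partialSum v (j + 1))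
  have hW0 : ∀ i j, 0 ≤ W i j := fun i j => overlap_nonneg _ _ _ _
  have hps0 : ∀ {n : ℕ} (t : stdSimplex ℝ (Fin n)) k, 0 ≤ partialSum t k := fun t k => by
    rw [← partialSum_zero t]
    exact partialSum_mono (stdSimplex.zero_le t) (Nat.zero_le k)
  have hps1 : ∀ {n : ℕ} (t : stdSimplex ℝ (Fin n)) (i : Fin n), partialSum t (i + 1) ≤ 1 :=
    fun t i => by
      rw [← stdSimplex.sum_eq_one t, ← partialSum_self t]
      exact partialSum_mono (stdSimplex.zero_le t) i.2
  have hWu : ∀ i, ∑ j, W i j = u i := fun i => by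
    have := sum_overlap hv (hps0 u i) (partialSum_mono hu (Nat.le_succ i))
      ((hps1 u i).trans (stdSimplex.sum_eq_one v).ge)
    rw [this, Nat.succ_eq_add_one, partialSum_succ, add_sub_cancel_left]
  have hWv : ∀ j, ∑ i, W i j = v j := fun j => by
    have := sum_overlap hu (hps0 v j) (partialSum_mono hv (Nat.le_succ j))
      ((hps1 v j).trans (stdSimplex.sum_eq_one u).ge)
    simp only [W]
    rw [Finset.sum_congr rfl fun i _ => overlap_comm _ _ _ _, this, Nat.succ_eq_add_one,
      partialSum_succ, add_sub_cancel_left]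
  have hWchain : ∀ {i i' j j'}, W i j ≠ 0 → W i' j' ≠ 0 → i < i' → j ≤ j' := by
    intro i i' j j' h1 h2 hi
    by_contra hj
    have h3 := (lt_of_overlap_ne_zero h1).2
    have h4 := (lt_of_overlap_ne_zero h2).1
    have h5 := partialSum_mono hu (show i.val + 1 ≤ i'.val from hi)
    have h6 := partialSum_mono hv (show j'.val + 1 ≤ j.val from not_le.1 hj)
    linarith
  have hWβγ : ∀ {i j}, W i j ≠ 0 → β i = γ j := by
    intro i j hij
    have h1 := lt_of_overlap_ne_zero hij
    by_contra hne
    rcases lt_or_gt_of_ne hne with h2 | h2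
    · exact absurd h1.2 (not_lt.2
        (partialSum_le_of_fiberwise hu hv β.monotone γ.monotone hβγ h2))
    · exact absurd h1.1 (not_lt.2
        (partialSum_le_of_fiberwise hv hu γ.monotone β.monotone (fun x => (hβγ x).symm) h2))
  -- By `hWchain` the pairs with positive overlap form a chain for the product order, so listing
  -- them lexicographically makes both projections monotone.
  let C : Finset (Fin (r + 1) ×ₗ Fin (s + 1)) :=
    Finset.univ.filter fun c => W (ofLex c).1 (ofLex c).2 ≠ 0
  have hCne : C.Nonempty := by
    by_contra hC
    rw [Finset.not_nonempty_iff_eq_empty, Finset.filter_eq_empty_iff] at hC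
    have h1 : ∀ i j, W i j = 0 := fun i j => not_not.1 (hC (Finset.mem_univ (toLex (i, j))))
    have h2 := stdSimplex.sum_eq_one u
    simp only [← hWu, h1, Finset.sum_const_zero, zero_ne_one] at h2
  obtain ⟨q, hq⟩ : ∃ q, C.card = q + 1 :=
    Nat.exists_eq_add_one.2 (Finset.card_pos.2 hCne)
  let e := C.orderEmbOfFin hq
  have heC : ∀ k, W (ofLex (e k)).1 (ofLex (e k)).2 ≠ 0 := fun k =>
    (Finset.mem_filter.1 (C.orderEmbOfFin_mem hq k)).2
  have hsum : ∀ F : Fin (r + 1) → Fin (s + 1) → ℝ, (∀ i j, W i j = 0 → F i j = 0) →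
      ∑ k, F (ofLex (e k)).1 (ofLex (e k)).2 = ∑ i, ∑ j, F i j := fun F hF => by
    have h1 : ∑ k, F (ofLex (e k)).1 (ofLex (e k)).2 = ∑ c ∈ C, F (ofLex c).1 (ofLex c).2 := by
      rw [← Finset.map_orderEmbOfFin_univ C hq, Finset.sum_map]
      rfl
    have h2 : ∑ c ∈ C, F (ofLex c).1 (ofLex c).2 =
        ∑ c : Fin (r + 1) ×ₗ Fin (s + 1), F (ofLex c).1 (ofLex c).2 :=
      Finset.sum_filter_of_ne fun c _ hc h0 => hc (hF _ _ h0)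
    rw [h1, h2, ← Fintype.sum_prod_type']
    exact ofLex.sum_comp fun c : Fin (r + 1) × Fin (s + 1) => F c.1 c.2
  let w : stdSimplex ℝ (Fin (q + 1)) := ⟨fun k => W (ofLex (e k)).1 (ofLex (e k)).2,
    fun k => hW0 _ _, by
      rw [hsum W fun _ _ h => h]
      simp only [hWu, stdSimplex.sum_eq_one]⟩
  have hw : ∀ k, w k = W (ofLex (e k)).1 (ofLex (e k)).2 := fun _ => rfl
  let p : Fin (q + 1) →o Fin (r + 1) :=
    ⟨fun k => (ofLex (e k)).1, fun k l hkl => Prod.Lex.monotone_fst _ _ (e.monotone hkl)⟩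
  let p' : Fin (q + 1) →o Fin (s + 1) :=
    ⟨fun k => (ofLex (e k)).2, fun k l hkl => by
      rcases Prod.Lex.le_iff.1 (e.monotone hkl) with h1 | h1
      · exact hWchain (heC k) (heC l) h1
      · exact h1.2⟩
  refine ⟨q, w, p, p', ?_, ?_, ?_⟩
  · refine stdSimplex.ext (funext fun i => ?_)
    rw [stdSimplex.map_apply_eq_sum, Finset.sum_filter]
    have := hsum (fun a b => if a = i then W a b else 0) fun a b h => by simp [h]
    simp only [hw]
    refine this.trans ?_
    rw [Finset.sum_comm]
    simp [hWu]
  · refine stdSimplex.ext (funext fun j => ?_)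
    rw [stdSimplex.map_apply_eq_sum, Finset.sum_filter]
    have := hsum (fun a b => if b = j then W a b else 0) fun a b h => by simp [h]
    simp only [hw]
    refine this.trans ?_
    simp [hWv]
  · ext k
    exact congrArg Fin.val (hWβγ (heC k))

end Coupling

theorem stdSimplex.map_eq_self {ι : Type*} [Fintype ι] (f : ι → ι) (t : stdSimplex ℝ ι)
    (h : ∀ i, t i ≠ 0 → f i = i) : stdSimplex.map f t = t := by
  classical
  refine stdSimplex.ext (funext fun x => ?_)
  rw [stdSimplex.map_apply_eq_sum, Finset.sum_filter]
  rw [Finset.sum_congr rfl (g := fun i => if i = x then t i else 0) fun i _ => by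
    by_cases hi : t i = 0
    · simp [hi]
    · rw [h i hi]]
  simp

theorem surjective_of_map_notMem_stdSimplexBoundary {m n : ℕ} {f : Fin (m + 1) → Fin (n + 1)}
    {t : stdSimplex ℝ (Fin (m + 1))} (h : stdSimplex.map f t ∉ stdSimplexBoundary n) :
    Function.Surjective f := by
  intro x
  by_contra hx
  refine h ⟨x, ?_⟩
  rw [stdSimplex.map_apply_eq_sum]
  refine Finset.sum_eq_zero fun i hi => absurd ⟨i, ?_⟩ hx
  exact (Finset.mem_filter.1 hi).2

/-! ### Equality of points in the realization -/

namespace SimplicialGSpace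

variable {G : Type u} [Group G] [TopologicalSpace G] {X Y : SimplicialObject (GSpaceCat G)}
  {l m n : SimplexCategory}

/-- The structure map `α^* : X_n → X_m` of a simplicial `G`-space. -/
abbrev pull (X : SimplicialObject (GSpaceCat G)) (α : m ⟶ n) :
    X.obj (op n) → X.obj (op m) := (X.map α.op).toFun

/-- The structure map `α_* : Δ^m → Δ^n`. -/
noncomputable abbrev push (α : m ⟶ n) (t : stdSimplex ℝ (Fin (m.len + 1))) :
    stdSimplex ℝ (Fin (n.len + 1)) := stdSimplex.map α.toOrderHom t

theorem continuous_pull (α : m ⟶ n) : Continuous (pull X α) := (X.map α.op).continuous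

theorem pull_comp (α : l ⟶ m) (β : m ⟶ n) (x : X.obj (op n)) :
    pull X (α ≫ β) x = pull X α (pull X β x) := by
  have := congrArg (fun h => GSpaceCat.Hom.toFun h x) (X.map_comp β.op α.op)
  exact this

theorem pull_id (x : X.obj (op n)) : pull X (𝟙 n) x = x := by
  have := congrArg (fun h => GSpaceCat.Hom.toFun h x) (X.map_id (op n))
  exact this

theorem app_pull (f : X ⟶ Y) (α : m ⟶ n) (x : X.obj (op n)) :
    (f.app (op m)).toFun (pull X α x) = pull Y α ((f.app (op n)).toFun x) := by
  have := congrArg (fun h => GSpaceCat.Hom.toFun h x) (f.naturality α.op)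
  exact this

theorem push_comp (α : l ⟶ m) (β : m ⟶ n) (t : stdSimplex ℝ (Fin (l.len + 1))) :
    push (α ≫ β) t = push β (push α t) := by
  rw [push, push, push, stdSimplex.map_comp_apply, SimplexCategory.comp_toOrderHom]
  rfl

theorem push_id (t : stdSimplex ℝ (Fin (n.len + 1))) : push (𝟙 n) t = t :=
  stdSimplex.map_id_apply t

theorem continuous_push (α : m ⟶ n) : Continuous (push α) := stdSimplex.continuous_map _

/-- The point of the realization represented by `(x, t)`. -/
def Realization.mk (n : SimplexCategory) (x : X.obj (op n))
    (t : stdSimplex ℝ (Fin (n.len + 1))) : Realization X := Quot.mk _ ⟨n, (x, t)⟩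

theorem Realization.ind {P : Realization X → Prop} (h : ∀ n x t, P (Realization.mk n x t))
    (z : Realization X) : P z := by
  induction z using Quot.ind with
  | mk p => exact h p.1 p.2.1 p.2.2

theorem Realization.glue (α : m ⟶ n) (x : X.obj (op n)) (t : stdSimplex ℝ (Fin (m.len + 1))) :
    Realization.mk m (pull X α x) t = Realization.mk n x (push α t) :=
  Quot.sound (Rel.glue α x t)

theorem Realization.continuous_mk (n : SimplexCategory) :
    Continuous fun p : X.obj (op n) × stdSimplex ℝ (Fin (n.len + 1)) =>
      Realization.mk n p.1 p.2 :=
  continuous_quot_mk.comp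
    (@continuous_sigmaMk _ (fun n => X.obj (op n) × SimplexCategory.toTop₀.obj n) _ n)

theorem Realization.isClosed_iff (C : Set (Realization X)) :
    IsClosed C ↔ ∀ n, IsClosed ((fun p : X.obj (op n) × stdSimplex ℝ (Fin (n.len + 1)) =>
      Realization.mk n p.1 p.2) ⁻¹' C) := by
  refine (isQuotientMap_quot_mk (r := Rel X)).isClosed_preimage.symm.trans ?_
  rw [isClosed_sigma_iff]
  rfl

theorem Realization.smul_mk (g : G) (n : SimplexCategory) (x : X.obj (op n))
    (t : stdSimplex ℝ (Fin (n.len + 1))) :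
    g • Realization.mk n x t = Realization.mk n (g • x) t := rfl

theorem realizationMap_mk (f : X ⟶ Y) (n : SimplexCategory) (x : X.obj (op n))
    (t : stdSimplex ℝ (Fin (n.len + 1))) :
    realizationMap f (Realization.mk n x t) = Realization.mk n ((f.app (op n)).toFun x) t := rfl

/-- Two representatives of points of the realization have a common refinement. -/
def HaveCommonRefinement (x : X.obj (op n)) (t : stdSimplex ℝ (Fin (n.len + 1)))
    (y : X.obj (op m)) (s : stdSimplex ℝ (Fin (m.len + 1))) : Prop :=
  ∃ (r : SimplexCategory) (w : stdSimplex ℝ (Fin (r.len + 1))) (α : r ⟶ n) (β : r ⟶ m),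
    push α w = t ∧ push β w = s ∧ pull X α x = pull X β y

namespace HaveCommonRefinement

theorem refl (x : X.obj (op n)) (t : stdSimplex ℝ (Fin (n.len + 1))) :
    HaveCommonRefinement x t x t := ⟨n, t, 𝟙 n, 𝟙 n, push_id t, push_id t, rfl⟩

theorem symm {x : X.obj (op n)} {t : stdSimplex ℝ (Fin (n.len + 1))}
    {y : X.obj (op m)} {s : stdSimplex ℝ (Fin (m.len + 1))} (h : HaveCommonRefinement x t y s) :
    HaveCommonRefinement y s x t := by
  obtain ⟨r, w, α, β, hα, hβ, h⟩ := h
  exact ⟨r, w, β, α, hβ, hα, h.symm⟩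

/-- The two refining points have the same image in the middle simplex, so `exists_common_refinement`
provides a point above both. -/
theorem trans {x : X.obj (op n)} {t : stdSimplex ℝ (Fin (n.len + 1))}
    {y : X.obj (op m)} {s : stdSimplex ℝ (Fin (m.len + 1))} {z : X.obj (op l)}
    {v : stdSimplex ℝ (Fin (l.len + 1))} (h : HaveCommonRefinement x t y s)
    (h' : HaveCommonRefinement y s z v) : HaveCommonRefinement x t z v := by
  obtain ⟨r, w, α, β, hα, hβ, h⟩ := h
  obtain ⟨r', w', α', β', hα', hβ', h'⟩ := h'
  obtain ⟨q, w'', p, p', hp, hp', hpp⟩ := exists_common_refinement w w' β.toOrderHom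
    α'.toOrderHom (hβ.trans hα'.symm)
  let π : SimplexCategory.mk q ⟶ r := SimplexCategory.Hom.mk p
  let π' : SimplexCategory.mk q ⟶ r' := SimplexCategory.Hom.mk p'
  have hπ : π ≫ β = π' ≫ α' := SimplexCategory.Hom.ext _ _ hpp
  refine ⟨SimplexCategory.mk q, w'', π ≫ α, π' ≫ β', ?_, ?_, ?_⟩
  · rw [push_comp, ← hα]
    exact congrArg _ hp
  · rw [push_comp, ← hβ']
    exact congrArg _ hp'
  · rw [pull_comp, h, ← pull_comp, hπ, pull_comp, h', ← pull_comp]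

theorem mk_eq_mk {x : X.obj (op n)} {t : stdSimplex ℝ (Fin (n.len + 1))}
    {y : X.obj (op m)} {s : stdSimplex ℝ (Fin (m.len + 1))} (h : HaveCommonRefinement x t y s) :
    Realization.mk n x t = Realization.mk m y s := by
  obtain ⟨r, w, α, β, rfl, rfl, h⟩ := h
  rw [← Realization.glue, ← Realization.glue, h]

/-- Too many vertices make `(α, β)` non-injective, and by monotonicity two consecutive vertices are
identified by both maps. Both then factor through the same degeneracy, which can be dropped. The
bound leaves finitely many shapes of refinement. -/
theorem exists_len_lt {x : X.obj (op n)} {t : stdSimplex ℝ (Fin (n.len + 1))}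
    {y : X.obj (op m)} {s : stdSimplex ℝ (Fin (m.len + 1))} (h : HaveCommonRefinement x t y s) :
    ∃ (r : Fin ((n.len + 1) * (m.len + 1))) (α : SimplexCategory.mk r ⟶ n)
      (β : SimplexCategory.mk r ⟶ m) (w : stdSimplex ℝ (Fin (r + 1))),
      push α w = t ∧ push β w = s ∧ pull X α x = pull X β y := by
  obtain ⟨r, w, α, β, hα, hβ, h⟩ := h
  obtain ⟨k⟩ := r
  induction k with
  | zero => exact ⟨⟨0, by positivity⟩, α, β, w, hα, hβ, h⟩
  | succ k ih =>
    by_cases hk : k + 1 < (n.len + 1) * (m.len + 1)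
    · exact ⟨⟨k + 1, hk⟩, α, β, w, hα, hβ, h⟩
    obtain ⟨i, hiα, hiβ⟩ : ∃ i : Fin (k + 1),
        α.toOrderHom i.castSucc = α.toOrderHom i.succ ∧
        β.toOrderHom i.castSucc = β.toOrderHom i.succ := by
      have hni : ¬ Function.Injective fun i : Fin (k + 2) => (α.toOrderHom i, β.toOrderHom i) := by
        intro hinj
        have := Fintype.card_le_of_injective _ hinj
        simp only [Fintype.card_prod, Fintype.card_fin] at this
        omega
      obtain ⟨a, b, hab, hne⟩ : ∃ a b : Fin (k + 2),
          (α.toOrderHom a, β.toOrderHom a) = (α.toOrderHom b, β.toOrderHom b) ∧ a < b := by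
        simp only [Function.Injective, not_forall] at hni
        obtain ⟨a, b, hab, hne⟩ := hni
        rcases lt_or_gt_of_ne hne with hlt | hlt
        · exact ⟨a, b, hab, hlt⟩
        · exact ⟨b, a, hab.symm, hlt⟩
      rw [Prod.mk.injEq] at hab
      have ha : a.val < k + 1 := by
        have := b.2
        have : a.val < b.val := hne
        omega
      have h1 : (⟨a.val, ha⟩ : Fin (k + 1)).castSucc = a := rfl
      have h2 : (⟨a.val, ha⟩ : Fin (k + 1)).succ ≤ b := by
        rw [Fin.le_def, Fin.val_succ]
        exact hne
      have h3 : a ≤ (⟨a.val, ha⟩ : Fin (k + 1)).succ := by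
        rw [Fin.le_def, Fin.val_succ]
        exact Nat.le_succ _
      refine ⟨⟨a.val, ha⟩, ?_, ?_⟩
      · rw [h1]
        exact le_antisymm (α.toOrderHom.monotone h3) (hab.1 ▸ α.toOrderHom.monotone h2)
      · rw [h1]
        exact le_antisymm (β.toOrderHom.monotone h3) (hab.2 ▸ β.toOrderHom.monotone h2)
    obtain ⟨α', rfl⟩ := SimplexCategory.eq_σ_comp_of_not_injective' α i hiα
    obtain ⟨β', rfl⟩ := SimplexCategory.eq_σ_comp_of_not_injective' β i hiβ
    refine ih (push (SimplexCategory.σ i) w) α' β' ?_ ?_ ?_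
    · rw [← push_comp, hα]
    · rw [← push_comp, hβ]
    -- The face is a section of the degeneracy, so pulling back along it cancels the degeneracy on
    -- both sides.
    · have := congrArg (pull X (SimplexCategory.δ i.castSucc)) h
      rwa [← pull_comp, ← pull_comp, ← Category.assoc, ← Category.assoc,
        SimplexCategory.δ_comp_σ_self, Category.id_comp, Category.id_comp] at this

end HaveCommonRefinement

/-- Having a common refinement is an equivalence relation containing `Rel`, and it implies equality
of classes. -/
theorem Realization.mk_eq_mk_iff {x : X.obj (op n)} {t : stdSimplex ℝ (Fin (n.len + 1))}
    {y : X.obj (op m)} {s : stdSimplex ℝ (Fin (m.len + 1))} :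
    Realization.mk n x t = Realization.mk m y s ↔ HaveCommonRefinement x t y s := by
  refine ⟨fun h => ?_, HaveCommonRefinement.mk_eq_mk⟩
  have key : ∀ p q : PreRealization X, Relation.EqvGen (Rel X) p q →
      HaveCommonRefinement (X := X) p.2.1 p.2.2 q.2.1 q.2.2 := by
    intro p q hpq
    induction hpq with
    | rel p q h =>
      obtain ⟨α, x, t⟩ := h
      exact ⟨_, t, 𝟙 _, α, push_id t, rfl, pull_id _⟩
    | refl p => exact .refl _ _
    | symm p q _ ih => exact ih.symm
    | trans p q r _ _ ih ih' => exact ih.trans ih'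
  exact key _ _ (Quot.eqvGen_exact h)

/-- For each of the finitely many shapes, the condition on simplex coordinates is a projection along
a compact simplex. The condition on the $X$-coordinates does not involve the refining point and is
closed by weak Hausdorffness. -/
theorem isClosed_haveCommonRefinement {K L : Type u} [TopologicalSpace K] [CompactSpace K]
    [T2Space K] [TopologicalSpace L] [CompactSpace L] [T2Space L]
    {x : K → X.obj (op n) × stdSimplex ℝ (Fin (n.len + 1))}
    {y : L → X.obj (op m) × stdSimplex ℝ (Fin (m.len + 1))} (hx : Continuous x)
    (hy : Continuous y) :
    IsClosed {p : K × L | HaveCommonRefinement (x p.1).1 (x p.1).2 (y p.2).1 (y p.2).2} := by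
  have h1 : {p : K × L | HaveCommonRefinement (x p.1).1 (x p.1).2 (y p.2).1 (y p.2).2} =
      ⋃ (r : Fin ((n.len + 1) * (m.len + 1))) (α : SimplexCategory.mk r ⟶ n)
        (β : SimplexCategory.mk r ⟶ m),
        (Prod.fst '' {q : (K × L) × stdSimplex ℝ (Fin (r + 1)) |
          push α q.2 = (x q.1.1).2 ∧ push β q.2 = (y q.1.2).2}) ∩
        {p | pull X α (x p.1).1 = pull X β (y p.2).1} := by
    ext p
    simp only [Set.mem_iUnion, Set.mem_inter_iff]
    constructor
    · intro h
      obtain ⟨r, α, β, w, hα, hβ, h⟩ := HaveCommonRefinement.exists_len_lt h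
      exact ⟨r, α, β, ⟨(p, w), ⟨hα, hβ⟩, rfl⟩, h⟩
    · rintro ⟨r, α, β, ⟨⟨p, w⟩, ⟨hα, hβ⟩, rfl⟩, h⟩
      exact ⟨SimplexCategory.mk r, w, α, β, hα, hβ, h⟩
  rw [h1]
  have hfin : ∀ a b : SimplexCategory, Finite (a ⟶ b) := fun a b =>
    Finite.of_injective (fun f : a ⟶ b => (f.toOrderHom : Fin (a.len + 1) → Fin (b.len + 1)))
      fun f g h => SimplexCategory.Hom.ext _ _ (DFunLike.coe_injective h)
  refine isClosed_iUnion_of_finite fun r => isClosed_iUnion_of_finite fun α =>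
    isClosed_iUnion_of_finite fun β => IsClosed.inter ?_ ?_
  · have h2 : IsClosed {q : (K × L) × stdSimplex ℝ (Fin (r.val + 1)) |
        push α q.2 = (x q.1.1).2} :=
      isClosed_eq ((continuous_push α).comp continuous_snd)
        (continuous_snd.comp (hx.comp (continuous_fst.comp continuous_fst)))
    have h3 : IsClosed {q : (K × L) × stdSimplex ℝ (Fin (r.val + 1)) |
        push β q.2 = (y q.1.2).2} :=
      isClosed_eq ((continuous_push β).comp continuous_snd)
        (continuous_snd.comp (hy.comp (continuous_snd.comp continuous_fst)))
    exact isClosedMap_fst_of_compactSpace _ (h2.inter h3)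
  · exact (X.obj _).isGSpace.weakHausdorff.isClosed_eq (K := K × L)
      ((continuous_pull α).comp (continuous_fst.comp (hx.comp continuous_fst)))
      ((continuous_pull β).comp (continuous_fst.comp (hy.comp continuous_snd)))

/-- The maps from compact Hausdorff spaces to the realization which lift to some
`X_n × Δ^n`. -/
def Realization.LiftableMap (X : SimplicialObject (GSpaceCat G)) (S : CompHaus.{u})
    (c : S → Realization X) : Prop :=
  ∃ (n : SimplexCategory) (x : S → X.obj (op n) × stdSimplex ℝ (Fin (n.len + 1))),
    Continuous x ∧ c = fun s => Realization.mk n (x s).1 (x s).2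

theorem Realization.isGenerating : IsGenerating (Realization.LiftableMap X) where
  continuous := by
    rintro S c ⟨n, x, hx, rfl⟩
    exact (Realization.continuous_mk n).comp hx
  exists_mem_range := Realization.ind fun n x t =>
    ⟨CompHaus.of PUnit, fun _ => Realization.mk n x t,
      ⟨n, fun _ => (x, t), continuous_const, rfl⟩, ⟨⟨⟩, rfl⟩⟩
  isClosed C hC := by
    rw [Realization.isClosed_iff]
    refine fun n => (X.obj (op n)).isGSpace.isGenerating.isClosed_prod _ fun S c hc => ?_
    exact hC (CompHaus.of (S × stdSimplex ℝ (Fin (n.len + 1)))) _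
      ⟨n, fun p => (c p.1, p.2), by fun_prop, rfl⟩

theorem isGSpace_realization (X : SimplicialObject (GSpaceCat G)) :
    IsGSpace G (Realization X) := by
  refine Realization.isGenerating.isGSpace ?_ ?_
  · rintro S S' c c' ⟨n, x, hx, rfl⟩ ⟨m, y, hy, rfl⟩
    simp only [Realization.mk_eq_mk_iff]
    exact isClosed_haveCommonRefinement hx hy
  · rintro S K c g ⟨n, x, hx, rfl⟩ hg
    refine (Realization.continuous_mk n).comp (Continuous.prodMk
      ((X.obj (op n)).isGSpace.continuous_smul_of_compact (K := S × K)
        (g := fun p => g p.2) (x := fun p => (x p.1).1) (by fun_prop) (by fun_prop)) ?_)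
    fun_prop

theorem continuous_realizationMap (f : X ⟶ Y) : Continuous (realizationMap f) :=
  Realization.isGenerating.continuous_of _ fun S c ⟨n, x, hx, hc⟩ => by
    subst hc
    have := (f.app (op n)).continuous
    exact (Realization.continuous_mk n).comp
      (show Continuous fun s => ((f.app (op n)).toFun (x s).1, (x s).2) by fun_prop)

/-- By naturality, and injectivity in the degree of the refinement, a refinement of the images
already refines the original points. -/
theorem realizationMap_injective (f : X ⟶ Y)
    (hf : ∀ n, Function.Injective (f.app (op n)).toFun) :
    Function.Injective (realizationMap f) := by
  refine Realization.ind fun n x t => Realization.ind fun m y s h => ?_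
  rw [realizationMap_mk, realizationMap_mk, Realization.mk_eq_mk_iff] at h
  obtain ⟨r, w, α, β, hα, hβ, h⟩ := h
  rw [← app_pull, ← app_pull] at h
  exact Realization.mk_eq_mk_iff.2 ⟨r, w, α, β, hα, hβ, hf r h⟩

end SimplicialGSpace

/-! ### Invariant subspaces and piecewise continuity -/

theorem IsGSpace.subMulAction {G : Type u} [Group G] [TopologicalSpace G] {X : Type u}
    [TopologicalSpace X] [MulAction G X] (hX : IsGSpace G X) (S : SubMulAction G X)
    (hS : IsClosed (S : Set X)) : IsGSpace G S where
  compactlyGenerated := hS.compactlyGeneratedSpace hX.compactlyGenerated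
  weakHausdorff := hX.weakHausdorff.subtype _
  continuous_smul := continuous_from_compactlyGenerated _ fun K p =>
    (hX.continuous_smul_of_compact (K := K) (g := fun k => (p k).1) (x := fun k => ((p k).2 : X))
      (by fun_prop) (by fun_prop)).subtype_mk _

theorem IsEquivariantNDR.act_mem_iff {G B : Type*} [TopologicalSpace B] {act : G → B → B}
    {A : Set B} (h : IsEquivariantNDR act A) (g : G) (b : B) : act g b ∈ A ↔ b ∈ A := by
  obtain ⟨v, φ, h⟩ := h
  rw [h.mem_iff, h.mem_iff, h.fun_act]

theorem Topology.IsEmbedding.continuousOn_range {A B Z : Type*} [TopologicalSpace A]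
    [TopologicalSpace B] [TopologicalSpace Z] {e : A → B} (he : IsEmbedding e) {F : B → Z}
    (hF : Continuous fun a => F (e a)) : ContinuousOn F (Set.range e) := by
  rw [continuousOn_iff_continuous_domRestrict]
  convert hF.comp he.toHomeomorph.symm.continuous using 1
  ext ⟨_, a, rfl⟩
  have : he.toHomeomorph.symm ⟨e a, a, rfl⟩ = a :=
    he.toHomeomorph.symm_apply_eq.2 rfl
  simp [this]

theorem ContinuousOn.iUnion_of_isClosed_of_finite {ι B Z : Type*} [Finite ι] [TopologicalSpace B]
    [TopologicalSpace Z] {F : B → Z} {S : ι → Set B} (hS : ∀ i, IsClosed (S i))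
    (hF : ∀ i, ContinuousOn F (S i)) : ContinuousOn F (⋃ i, S i) :=
  (locallyFinite_of_finite S).continuousOn_iUnion hS fun {i} => hF i

/-! ### Nondegenerate representatives and latching spaces -/

namespace SimplicialGSpace

open SimplexCategory renaming mk → simplex

variable {G : Type u} [Group G] [TopologicalSpace G] {X Y : SimplicialObject (GSpaceCat G)}
  {m n : SimplexCategory}

theorem exists_section {α : m ⟶ n} (h : Function.Surjective α.toOrderHom)
    (j : Fin (m.len + 1)) :
    ∃ s : n ⟶ m, s ≫ α = 𝟙 n ∧ s.toOrderHom (α.toOrderHom j) = j := by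
  classical
  let s : Fin (n.len + 1) → Fin (m.len + 1) :=
    Function.update (Function.surjInv h) (α.toOrderHom j) j
  have hs : ∀ i, α.toOrderHom (s i) = i := fun i => by
    by_cases hi : i = α.toOrderHom j
    · subst hi
      simp [s]
    · simp [s, hi, Function.surjInv_eq h]
  -- Any set-theoretic section of a monotone map between linear orders is monotone, so the value at
  -- one vertex may be prescribed freely.
  have hmono : Monotone s := fun i i' hii => by
    by_contra hlt
    have h1 := α.toOrderHom.monotone (not_le.1 hlt).le
    rw [hs, hs] at h1
    exact hlt (congrArg s (le_antisymm hii h1)).le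
  refine ⟨SimplexCategory.Hom.mk ⟨s, hmono⟩, ?_, ?_⟩
  · refine SimplexCategory.Hom.ext _ _ (OrderHom.ext _ _ (funext hs))
  · exact Function.update_self _ _ _

theorem injective_of_pull_notMem_latchingSet {n : ℕ} {y : X.obj (op (simplex n))}
    (hy : y ∉ latchingSet X n) (θ : (simplex n) ⟶ m) (y' : X.obj (op m)) (h : y = pull X θ y') :
    Function.Injective θ.toOrderHom := by
  cases n with
  | zero => exact Function.injective_of_subsingleton (α := Fin 1) _
  | succ n =>
    by_contra hθ
    obtain ⟨i, θ', rfl⟩ := SimplexCategory.eq_σ_comp_of_not_injective θ hθ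
    exact hy (Set.mem_iUnion.2 ⟨i, pull X θ' y', by rw [h, pull_comp]; rfl⟩)

/-- An interior `t` makes `α` surjective. A section `s` of it exhibits `y` as the pullback of `y'`
along `s ≫ β`, which is injective because `y` is nondegenerate. -/
theorem le_of_mk_eq_mk {n k : ℕ} {y : X.obj (op (simplex n))} {t : stdSimplex ℝ (Fin (n + 1))}
    (hy : y ∉ latchingSet X n) (ht : t ∉ stdSimplexBoundary n) {y' : X.obj (op (simplex k))}
    {t' : stdSimplex ℝ (Fin (k + 1))}
    (h : Realization.mk (simplex n) y t = Realization.mk (simplex k) y' t') : n ≤ k := by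
  obtain ⟨r, w, α, β, rfl, rfl, hαβ⟩ := Realization.mk_eq_mk_iff.1 h
  obtain ⟨s, hs, -⟩ := exists_section (surjective_of_map_notMem_stdSimplexBoundary ht) 0
  have h1 : y = pull X (s ≫ β) y' := by
    rw [pull_comp, ← hαβ, ← pull_comp, hs, pull_id]
  have h2 := Fintype.card_le_of_injective _ (injective_of_pull_notMem_latchingSet hy _ _ h1)
  simpa using h2

/-- For every section `s` of `α`, the map `s ≫ β` is an injective monotone endomorphism, hence the
identity. This gives `y = y'`; sections through each vertex give `α = β`. -/
theorem eq_of_mk_eq_mk {n : ℕ} {y y' : X.obj (op (simplex n))} {t t' : stdSimplex ℝ (Fin (n + 1))}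
    (hy : y ∉ latchingSet X n) (ht : t ∉ stdSimplexBoundary n)
    (h : Realization.mk (simplex n) y t = Realization.mk (simplex n) y' t') : y = y' ∧ t = t' := by
  obtain ⟨r, w, α, β, rfl, rfl, hαβ⟩ := Realization.mk_eq_mk_iff.1 h
  have hα := surjective_of_map_notMem_stdSimplexBoundary ht
  have h1 : ∀ s : simplex n ⟶ r, s ≫ α = 𝟙 _ →
      y = pull X (s ≫ β) y' ∧ s ≫ β = 𝟙 _ := fun s hs => by
    have h2 : y = pull X (s ≫ β) y' := by
      rw [pull_comp, ← hαβ, ← pull_comp, hs, pull_id]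
    have := SimplexCategory.mono_iff_injective.2 (injective_of_pull_notMem_latchingSet hy _ _ h2)
    exact ⟨h2, SimplexCategory.eq_id_of_mono _⟩
  constructor
  · obtain ⟨s, hs, -⟩ := exists_section hα 0
    obtain ⟨h2, h3⟩ := h1 s hs
    rw [h2, h3, pull_id]
  · have : α = β := by
      refine SimplexCategory.Hom.ext _ _ (OrderHom.ext _ _ (funext fun j => ?_))
      obtain ⟨s, hs, hj⟩ := exists_section hα j
      have h2 := congrArg (fun θ => θ.toOrderHom (α.toOrderHom j)) (h1 s hs).2
      rw [← hj]
      simp only [SimplexCategory.comp_toOrderHom, OrderHom.comp_coe, Function.comp] at h2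
      rw [h2, hj]
      rfl
    rw [this]

theorem mem_range_of_realizationMap_eq_mk (f : X ⟶ Y) {n : ℕ} {y : Y.obj (op (simplex n))}
    {t : stdSimplex ℝ (Fin (n + 1))} (ht : t ∉ stdSimplexBoundary n) (z : Realization X)
    (h : realizationMap f z = Realization.mk (simplex n) y t) :
    y ∈ Set.range (f.app (op (simplex n))).toFun := by
  induction z using Realization.ind with
  | h k x v =>
    rw [realizationMap_mk] at h
    obtain ⟨r, w, α, β, rfl, rfl, hαβ⟩ := Realization.mk_eq_mk_iff.1 h.symm
    obtain ⟨s, hs, -⟩ := exists_section (surjective_of_map_notMem_stdSimplexBoundary ht) 0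
    refine ⟨pull X (s ≫ β) x, ?_⟩
    rw [app_pull, pull_comp, ← hαβ, ← pull_comp, hs, pull_id]

theorem pull_σ_pull_δ_of_mem_range {n : ℕ} (i : Fin (n + 1)) {y : X.obj (op (simplex (n + 1)))}
    (hy : y ∈ Set.range (X.σ i).toFun) :
    pull X (SimplexCategory.σ i) (pull X (SimplexCategory.δ i.castSucc) y) = y := by
  obtain ⟨y, rfl⟩ := hy
  change pull X _ (pull X _ (pull X (SimplexCategory.σ i) y)) = pull X _ y
  rw [← pull_comp (X := X) (SimplexCategory.δ i.castSucc), SimplexCategory.δ_comp_σ_self, pull_id]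

/-- The range is the fixed set of the continuous idempotent `s_i d_i`, closed by weak Hausdorffness.
-/
theorem isClosed_range_σ {n : ℕ} (i : Fin (n + 1)) :
    IsClosed (Set.range (X.σ i).toFun) := by
  convert (X.obj (op (simplex (n + 1)))).isGSpace.isClosed_eq
    (X.obj (op (simplex (n + 1)))).isGSpace.compactlyGenerated
    ((continuous_pull (X := X) (SimplexCategory.σ i)).comp
      (continuous_pull (SimplexCategory.δ i.castSucc))) continuous_id using 1
  ext y
  exact ⟨pull_σ_pull_δ_of_mem_range i, fun h => ⟨_, h⟩⟩

theorem isClosed_latchingSet (n : ℕ) : IsClosed (latchingSet X n) := by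
  cases n with
  | zero => exact isClosed_empty
  | succ n => exact isClosed_iUnion_of_finite isClosed_range_σ

theorem isGSpace_latching (X : SimplicialObject (GSpaceCat G)) (n : ℕ) :
    IsGSpace G (latching X n) :=
  (X.obj _).isGSpace.subMulAction _ (isClosed_latchingSet n)

/-- If `f x` is degenerate along `s_i`, then `s_i d_i` fixes it. By injectivity it also fixes `x`.
-/
theorem latchingSet_inter_range (f : X ⟶ Y) {n : ℕ}
    (hf : Function.Injective (f.app (op (simplex n))).toFun) :
    latchingSet Y n ∩ Set.range (f.app (op (simplex n))).toFun =
      (f.app (op (simplex n))).toFun '' latchingSet X n := by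
  cases n with
  | zero => simp [latchingSet]
  | succ n =>
    ext y
    constructor
    · rintro ⟨hy, x, rfl⟩
      obtain ⟨i, hi⟩ := Set.mem_iUnion.1 hy
      refine ⟨x, Set.mem_iUnion.2 ⟨i, pull X (SimplexCategory.δ i.castSucc) x, hf ?_⟩, rfl⟩
      change (f.app _).toFun (pull X (SimplexCategory.σ i) _) = _
      rw [app_pull, app_pull, pull_σ_pull_δ_of_mem_range i hi]
    · rintro ⟨x, hx, rfl⟩
      obtain ⟨i, x, rfl⟩ := Set.mem_iUnion.1 hx
      refine ⟨Set.mem_iUnion.2 ⟨i, (f.app _).toFun x, ?_⟩, _, rfl⟩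
      exact (app_pull f (SimplexCategory.σ i) x).symm

theorem isEquivariantNDR_latchingSet_union_range (f : X ⟶ Y) (hX : IsReedyCofibrant X)
    (hY : IsReedyCofibrant Y) {n : ℕ} (hf : IsGCofibration G (f.app (op (simplex n))).toFun) :
    IsEquivariantNDR (fun (g : G) (y : Y.obj (op (simplex n))) => g • y)
      (latchingSet Y n ∪ Set.range (f.app (op (simplex n))).toFun) := by
  have hXn := (X.obj (op (simplex n))).isGSpace
  have hYn := (Y.obj (op (simplex n))).isGSpace
  refine IsEquivariantNDR.union ?_ (hf.isEquivariantNDR hXn hYn) ?_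
  · have := (hY n).isEquivariantNDR (isGSpace_latching Y n) hYn
    rwa [Subtype.range_val] at this
  · have := (hf.comp (hX n)).isEquivariantNDR (isGSpace_latching X n) hYn
    rw [Set.range_comp, Subtype.range_val] at this
    rwa [latchingSet_inter_range f (hf.isClosedEmbedding hXn hYn).injective]

/-- A point of a face of the simplex is fixed by a retraction onto the face. -/
theorem exists_push_push_eq_self {n : ℕ} (i : Fin (n + 2)) :
    ∃ j : Fin (n + 1), ∀ t : stdSimplex ℝ (Fin (n + 2)), t i = 0 →
      push (SimplexCategory.δ i) (push (SimplexCategory.σ j) t) = t := by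
  obtain ⟨j, hj⟩ : ∃ j : Fin (n + 1), ∀ k, k ≠ i → i.succAbove (j.predAbove k) = k := by
    refine Fin.cases ⟨0, fun k hk => ?_⟩ (fun j => ⟨j, fun k hk => ?_⟩) i
    · exact Fin.succAbove_predAbove (p := (0 : Fin (n + 1))) hk
    · exact Fin.succ_succAbove_predAbove hk
  refine ⟨j, fun t ht => ?_⟩
  rw [← push_comp]
  refine stdSimplex.map_eq_self _ t fun k hk => hj k ?_
  rintro rfl
  exact hk ht

end SimplicialGSpace

/-! ### Extension of homotopies over the skeleta -/

namespace SimplicialGSpace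

open SimplexCategory renaming mk → simplex

variable {G : Type u} [Group G] [TopologicalSpace G] {X Y : SimplicialObject (GSpaceCat G)}
  {Z : Type u} [TopologicalSpace Z] [MulAction G Z]

/-- A function on `|Y| × I` which is equivariant, extends given data on `|Y| × 0` and `|X| × I`, and
is continuous on the skeleton of dimension less than `n`. -/
structure IsPartialExtension (f : X ⟶ Y) (h : Realization Y → Z) (H : Realization X × I → Z)
    (n : ℕ) (F : Realization Y × I → Z) : Prop where
  continuous : ∀ k < n, Continuous
    fun p : (Y.obj (op (simplex k)) × stdSimplex ℝ (Fin (k + 1))) × I =>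
      F (Realization.mk (simplex k) p.1.1 p.1.2, p.2)
  map_smul : ∀ (g : G) z t, F (g • z, t) = g • F (z, t)
  apply_zero : ∀ z, F (z, 0) = h z
  apply_realizationMap : ∀ w t, F (realizationMap f w, t) = H (w, t)

/-- The part of `Y_n × Δ^n` on which an extension over the lower skeleta and over the image of `X`
is already determined. -/
def relativeBoundary (f : X ⟶ Y) (n : ℕ) :
    Set (Y.obj (op (simplex n)) × stdSimplex ℝ (Fin (n + 1))) :=
  {p | p.1 ∈ latchingSet Y n ∪ Set.range (f.app (op (simplex n))).toFun ∨ p.2 ∈ stdSimplexBoundary n}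

variable {f : X ⟶ Y} {h : Realization Y → Z} {H : Realization X × I → Z} {n : ℕ}
  {F : Realization Y × I → Z}

/-- The set is a finite union of closed pieces. On degenerate simplices and on faces, the function
factors continuously through dimension `n - 1`; on the image of `X` it is `H`, transported along a
closed embedding. -/
theorem IsPartialExtension.continuousOn_relativeBoundary (hF : IsPartialExtension f h H n F)
    (hH : Continuous H) (hf : IsClosedEmbedding (f.app (op (simplex n))).toFun) :
    ContinuousOn (fun p : (Y.obj (op (simplex n)) × stdSimplex ℝ (Fin (n + 1))) × I =>
      F (Realization.mk (simplex n) p.1.1 p.1.2, p.2)) (relativeBoundary f n ×ˢ Set.univ) := by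
  let F' : (Y.obj (op (simplex n)) × stdSimplex ℝ (Fin (n + 1))) × I → Z := fun p =>
    F (Realization.mk (simplex n) p.1.1 p.1.2, p.2)
  have h1 : ContinuousOn F' {p | p.1.1 ∈ latchingSet Y n} := by
    cases n with
    | zero => exact continuousOn_empty _
    | succ n =>
      have : {p : (Y.obj (op (simplex (n + 1))) × stdSimplex ℝ (Fin (n + 2))) × I |
          p.1.1 ∈ latchingSet Y (n + 1)} =
          ⋃ i : Fin (n + 1), {p | p.1.1 ∈ Set.range (Y.σ i).toFun} := by
        ext p
        simp [latchingSet]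
      rw [this]
      refine ContinuousOn.iUnion_of_isClosed_of_finite
        (fun i => (isClosed_range_σ i).preimage (continuous_fst.comp continuous_fst)) fun i => ?_
      have hc : Continuous fun p : (Y.obj (op (simplex (n + 1))) × stdSimplex ℝ (Fin (n + 2))) × I =>
          F (Realization.mk (simplex n) (pull Y (SimplexCategory.δ i.castSucc) p.1.1)
            (push (SimplexCategory.σ i) p.1.2), p.2) :=
        (hF.continuous n (Nat.lt_succ_self n)).comp
          ((((continuous_pull _).comp (continuous_fst.comp continuous_fst)).prodMk
            ((continuous_push _).comp (continuous_snd.comp continuous_fst))).prodMk continuous_snd)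
      refine hc.continuousOn.congr fun p hp => ?_
      simp only [F']
      rw [← Realization.glue, pull_σ_pull_δ_of_mem_range i hp]
  have h2 : ContinuousOn F' {p | p.1.2 ∈ stdSimplexBoundary n} := by
    have : {p : (Y.obj (op (simplex n)) × stdSimplex ℝ (Fin (n + 1))) × I |
        p.1.2 ∈ stdSimplexBoundary n} = ⋃ i : Fin (n + 1), {p | p.1.2 i = 0} := by
      ext p
      simp [stdSimplexBoundary]
    rw [this]
    refine ContinuousOn.iUnion_of_isClosed_of_finite
      (fun i => isClosed_eq ((stdSimplex.continuous_eval i).comp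
        (continuous_snd.comp continuous_fst)) continuous_const) fun i => ?_
    cases n with
    -- The 0-simplex has empty boundary: its only coordinate is 1.
    | zero =>
      refine (continuousOn_empty _).mono fun p hp => ?_
      have h0 := stdSimplex.sum_eq_one p.1.2
      rw [Fin.sum_univ_one, ← Subsingleton.elim (α := Fin 1) i 0, show p.1.2 i = 0 from hp] at h0
      exact absurd h0 zero_ne_one
    | succ n =>
      obtain ⟨j, hj⟩ := exists_push_push_eq_self i
      have hc : Continuous fun p : (Y.obj (op (simplex (n + 1))) × stdSimplex ℝ (Fin (n + 2))) × I =>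
          F (Realization.mk (simplex n) (pull Y (SimplexCategory.δ i) p.1.1)
            (push (SimplexCategory.σ j) p.1.2), p.2) :=
        (hF.continuous n (Nat.lt_succ_self n)).comp
          ((((continuous_pull _).comp (continuous_fst.comp continuous_fst)).prodMk
            ((continuous_push _).comp (continuous_snd.comp continuous_fst))).prodMk continuous_snd)
      refine hc.continuousOn.congr fun p hp => ?_
      simp only [F']
      rw [Realization.glue, hj _ hp]
  have h3 : ContinuousOn F' {p | p.1.1 ∈ Set.range (f.app (op (simplex n))).toFun} := by
    let e : (X.obj (op (simplex n)) × stdSimplex ℝ (Fin (n + 1))) × I →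
        (Y.obj (op (simplex n)) × stdSimplex ℝ (Fin (n + 1))) × I :=
      Prod.map (Prod.map (f.app (op (simplex n))).toFun id) id
    have he : IsEmbedding e :=
      (hf.isEmbedding.prodMap IsEmbedding.id).prodMap IsEmbedding.id
    have hc : Continuous fun a => F' (e a) := by
      have : (fun a => F' (e a)) = fun a => H (Realization.mk (simplex n) a.1.1 a.1.2, a.2) :=
        funext fun a => hF.apply_realizationMap (Realization.mk (simplex n) a.1.1 a.1.2) a.2
      rw [this]
      exact hH.comp (((Realization.continuous_mk (X := X) (simplex n)).comp continuous_fst).prodMk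
        continuous_snd)
    refine (he.continuousOn_range hc).mono ?_
    rintro ⟨⟨_, t⟩, s⟩ ⟨x, rfl⟩
    exact ⟨((x, t), s), rfl⟩
  have c1 : IsClosed {p : (Y.obj (op (simplex n)) × stdSimplex ℝ (Fin (n + 1))) × I |
      p.1.1 ∈ latchingSet Y n} :=
    (isClosed_latchingSet n).preimage (continuous_fst.comp continuous_fst)
  have c2 : IsClosed {p : (Y.obj (op (simplex n)) × stdSimplex ℝ (Fin (n + 1))) × I |
      p.1.2 ∈ stdSimplexBoundary n} :=
    (isClosed_stdSimplexBoundary n).preimage (continuous_snd.comp continuous_fst)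
  have c3 : IsClosed {p : (Y.obj (op (simplex n)) × stdSimplex ℝ (Fin (n + 1))) × I |
      p.1.1 ∈ Set.range (f.app (op (simplex n))).toFun} :=
    hf.isClosed_range.preimage (continuous_fst.comp continuous_fst)
  refine ((h1.union_of_isClosed h3 c1 c3).union_of_isClosed h2 (c1.union c3) c2).mono ?_
  rintro p ⟨hp, -⟩
  exact hp

-- Since `F` is already defined everywhere, it only has to be corrected at points represented
-- outside the relative boundary. Their representative in dimension `n` is unique, so the extension
-- `E` prescribes the new value unambiguously.
open Classical in
theorem IsPartialExtension.exists_succ (hF : IsPartialExtension f h H n F)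
    (hh : Continuous h) (hhG : ∀ (g : G) z, h (g • z) = g • h z) (hH : Continuous H)
    (hf : IsClosedEmbedding (f.app (op (simplex n))).toFun)
    (hNDR : IsEquivariantNDR (fun (g : G) (y : Y.obj (op (simplex n))) => g • y)
      (latchingSet Y n ∪ Set.range (f.app (op (simplex n))).toFun)) :
    ∃ F', IsPartialExtension f h H (n + 1) F' ∧
      ∀ k < n, ∀ y t s, F' (Realization.mk (simplex k) y t, s) = F (Realization.mk (simplex k) y t, s) := by
  have hA := hNDR.act_mem_iff
  obtain ⟨v, φ, hφ⟩ := hNDR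
  obtain ⟨w, ψ, hψ⟩ := isEquivariantNDR_stdSimplexBoundary G n
  obtain ⟨E, hE, hEG, hE0, hEF, -⟩ := (hφ.prod hψ).exists_extension (fun (g : G) (z : Z) => g • z)
    (f := fun p => h (Realization.mk (simplex n) p.1 p.2))
    (H := fun p => F (Realization.mk (simplex n) p.1.1 p.1.2, p.2))
    (hh.comp (Realization.continuous_mk _)) (hF.continuousOn_relativeBoundary hH hf)
    (fun g p => hhG g (Realization.mk (simplex n) p.1 p.2))
    (fun g p _ t => hF.map_smul g (Realization.mk (simplex n) p.1 p.2) t)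
    (fun p _ => hF.apply_zero _)
  let IsNew : Realization Y → Prop := fun z =>
    ∃ p : Y.obj (op (simplex n)) × stdSimplex ℝ (Fin (n + 1)),
      p ∉ relativeBoundary f n ∧ z = Realization.mk (simplex n) p.1 p.2
  let F' : Realization Y × I → Z := fun p =>
    if hp : IsNew p.1 then E (hp.choose, p.2) else F p
  have hsplit : ∀ p : Y.obj (op (simplex n)) × stdSimplex ℝ (Fin (n + 1)), p ∉ relativeBoundary f n →
      p.1 ∉ latchingSet Y n ∧ p.1 ∉ Set.range (f.app (op (simplex n))).toFun ∧
        p.2 ∉ stdSimplexBoundary n := fun p hp => by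
    obtain ⟨h1, h2⟩ := not_or.1 hp
    obtain ⟨h3, h4⟩ := not_or.1 h1
    exact ⟨h3, h4, h2⟩
  have hF'new : ∀ p ∉ relativeBoundary f n, ∀ s,
      F' (Realization.mk (simplex n) p.1 p.2, s) = E (p, s) := fun p hp s => by
    have hz : IsNew (Realization.mk (simplex n) p.1 p.2) := ⟨p, hp, rfl⟩
    have h1 : F' (Realization.mk (simplex n) p.1 p.2, s) = E (hz.choose, s) := dif_pos hz
    obtain ⟨h2, -, h3⟩ := hsplit p hp
    obtain ⟨h4, h5⟩ := eq_of_mk_eq_mk h2 h3 hz.choose_spec.2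
    rw [h1, ← (Prod.ext h4 h5 : p = hz.choose)]
  have hF'old : ∀ z, ¬ IsNew z → ∀ s, F' (z, s) = F (z, s) := fun z hz s => dif_neg hz
  -- On the relative boundary nothing was changed and `E` agrees with `F`, so `F'` is `E` on all of
  -- $Y_n\times\Delta^n$. This gives continuity in dimension `n`.
  have hF'E : ∀ p s, F' (Realization.mk (simplex n) p.1 p.2, s) = E (p, s) := fun p s => by
    by_cases hp : p ∈ relativeBoundary f n
    · rw [hF'old, hEF p hp]
      rintro ⟨q, hq, hpq⟩
      obtain ⟨h2, -, h3⟩ := hsplit q hq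
      obtain ⟨h4, h5⟩ := eq_of_mk_eq_mk h2 h3 hpq.symm
      exact hq ((Prod.ext h4 h5 : q = p) ▸ hp)
    · exact hF'new p hp s
  have hlow : ∀ k < n, ∀ y t, ¬ IsNew (Realization.mk (simplex k) y t) := by
    rintro k hk y t ⟨q, hq, hpq⟩
    obtain ⟨h2, -, h3⟩ := hsplit q hq
    exact absurd (le_of_mk_eq_mk h2 h3 hpq.symm) (not_le.2 hk)
  have hnewG : ∀ (g : G) z, IsNew z → IsNew (g • z) := by
    rintro g _ ⟨p, hp, rfl⟩
    refine ⟨(g • p.1, p.2), ?_, rfl⟩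
    rintro (h1 | h1)
    · exact hp (Or.inl ((hA g p.1).1 h1))
    · exact hp (Or.inr h1)
  refine ⟨F', ⟨?_, ?_, ?_, ?_⟩, fun k hk y t s => hF'old _ (hlow k hk y t) s⟩
  · intro k hk
    rcases (Nat.lt_succ_iff.1 hk).lt_or_eq with h1 | rfl
    · convert hF.continuous k h1 using 2 with p
      exact hF'old _ (hlow k h1 _ _) _
    · convert hE using 2 with p
      exact hF'E p.1 p.2
  · intro g z t
    by_cases hz : IsNew z
    · obtain ⟨p, hp, rfl⟩ := hz
      rw [hF'E]
      exact (hF'E (g • p.1, p.2) t).trans (hEG g p t)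
    · rw [hF'old z hz, hF'old, hF.map_smul]
      intro h1
      have h2 := hnewG g⁻¹ _ h1
      rw [inv_smul_smul] at h2
      exact hz h2
  · intro z
    by_cases hz : IsNew z
    · obtain ⟨p, hp, rfl⟩ := hz
      rw [hF'E, hE0]
    · rw [hF'old z hz, hF.apply_zero]
  · intro w t
    rw [hF'old, hF.apply_realizationMap]
    rintro ⟨p, hp, hw⟩
    obtain ⟨-, h2, h3⟩ := hsplit p hp
    exact h2 (mem_range_of_realizationMap_eq_mk f h3 w hw)

-- No continuity is required at stage 0, so `H` is used on the image of $|X|$ and the constant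
-- homotopy at `h` elsewhere; equivariance holds because the image is invariant.
open Classical in
theorem exists_isPartialExtension_zero (hinj : Function.Injective (realizationMap f))
    (hhG : ∀ (g : G) z, h (g • z) = g • h z)
    (hHG : ∀ (g : G) w t, H (g • w, t) = g • H (w, t))
    (hfG : ∀ (g : G) w, realizationMap f (g • w) = g • realizationMap f w)
    (h0 : ∀ w, H (w, 0) = h (realizationMap f w)) :
    ∃ F, IsPartialExtension f h H 0 F := by
  let F : Realization Y × I → Z := fun p =>
    if hp : p.1 ∈ Set.range (realizationMap f) then H (hp.choose, p.2) else h p.1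
  have hF1 : ∀ w t, F (realizationMap f w, t) = H (w, t) := fun w t => by
    have hw : realizationMap f w ∈ Set.range (realizationMap f) := ⟨w, rfl⟩
    have h1 : F (realizationMap f w, t) = H (hw.choose, t) := dif_pos hw
    rw [h1, hinj hw.choose_spec]
  have hF2 : ∀ z, z ∉ Set.range (realizationMap f) → ∀ t, F (z, t) = h z := fun z hz t =>
    dif_neg hz
  refine ⟨F, fun k hk => absurd hk (Nat.not_lt_zero k), ?_, ?_, hF1⟩
  · intro g z t
    by_cases hz : z ∈ Set.range (realizationMap f)
    · obtain ⟨w, rfl⟩ := hz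
      rw [← hfG, hF1, hF1, hHG]
    · rw [hF2 z hz, hF2, hhG]
      rintro ⟨w, hw⟩
      exact hz ⟨g⁻¹ • w, by rw [hfG, hw, inv_smul_smul]⟩
  · intro z
    by_cases hz : z ∈ Set.range (realizationMap f)
    · obtain ⟨w, rfl⟩ := hz
      rw [hF1, h0]
    · rw [hF2 z hz]

theorem exists_extension_of_forall_isPartialExtension {F : ℕ → Realization Y × I → Z}
    (hF : ∀ n, IsPartialExtension f h H n (F n))
    (hstep : ∀ n, ∀ k < n, ∀ y t s,
      F (n + 1) (Realization.mk (simplex k) y t, s) = F n (Realization.mk (simplex k) y t, s)) :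
    ∃ F' : Realization Y × I → Z, Continuous F' ∧ ∀ n, IsPartialExtension f h H n F' := by
  have hdeg : ∀ z : Realization Y, ∃ k : ℕ, ∃ y t, z = Realization.mk (simplex k) y t :=
    Realization.ind fun n y t => ⟨n.len, y, t, rfl⟩
  choose d hd using hdeg
  -- The sequence is constant on dimension `k` from stage `k + 1` on, so any choice of representing
  -- dimension gives the eventual value.
  let F' : Realization Y × I → Z := fun p => F (d p.1 + 1) p
  have hstab : ∀ k y t s m, F (k + 1 + m) (Realization.mk (simplex k) y t, s) =
      F (k + 1) (Realization.mk (simplex k) y t, s) := fun k y t s m => by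
    induction m with
    | zero => rfl
    | succ m ih => rw [← add_assoc, hstep _ k (by omega), ih]
  have hF' : ∀ k y t s, F' (Realization.mk (simplex k) y t, s) =
      F (k + 1) (Realization.mk (simplex k) y t, s) := fun k y t s => by
    change F (d (Realization.mk (simplex k) y t) + 1) _ = _
    obtain ⟨y', t', h1⟩ := hd (Realization.mk (simplex k) y t)
    generalize d (Realization.mk (simplex k) y t) = k' at y' t' h1 ⊢
    -- Values computed from dimensions `k` and `k'` are compared at the common stage `k + k' + 2`.
    rw [← hstab k y t s (k' + 1), h1, ← hstab k' y' t' s (k + 1), add_comm]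
  have hcont : ∀ k, Continuous fun p : (Y.obj (op (simplex k)) × stdSimplex ℝ (Fin (k + 1))) × I =>
      F' (Realization.mk (simplex k) p.1.1 p.1.2, p.2) := fun k => by
    simp only [hF']
    exact (hF (k + 1)).continuous k (Nat.lt_succ_self k)
  refine ⟨F', Realization.isGenerating.continuous_prod _ ?_, fun n => ⟨fun k _ => hcont k, ?_,
    fun z => (hF _).apply_zero z, fun w t => (hF _).apply_realizationMap w t⟩⟩
  · rintro S c ⟨⟨k⟩, x, hx, rfl⟩
    exact (hcont k).comp ((hx.comp continuous_fst).prodMk continuous_snd)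
  · intro g z t
    obtain ⟨y, s, hz⟩ := hd z
    rw [hz, hF']
    exact (hF' _ _ _ _).trans ((hF _).map_smul g (Realization.mk _ y s) t)

theorem isGCofibration_realizationMap (f : X ⟶ Y) (hX : IsReedyCofibrant X)
    (hY : IsReedyCofibrant Y)
    (hf : ∀ n : ℕ, IsGCofibration G (f.app (op (simplex n))).toFun) :
    IsGCofibration G (realizationMap f) := by
  have hfe : ∀ n : ℕ, IsClosedEmbedding (f.app (op (simplex n))).toFun := fun n =>
    (hf n).isClosedEmbedding (X.obj _).isGSpace (Y.obj _).isGSpace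
  have hfG : ∀ (g : G) w, realizationMap f (g • w) = g • realizationMap f w := fun g =>
    Realization.ind fun n x t => by
      rw [Realization.smul_mk, realizationMap_mk, (f.app (op n)).map_smul]
      rfl
  refine ⟨continuous_realizationMap f, hfG, fun Z _ _ _ h H hh hhG hH hHG h0 => ?_⟩
  obtain ⟨F₀, hF₀⟩ := exists_isPartialExtension_zero
    (realizationMap_injective f fun n => (hfe n.len).injective) hhG hHG hfG h0
  choose next hnext hnext' using fun (n : ℕ) (F : {F // IsPartialExtension f h H n F}) =>
    F.2.exists_succ hh hhG hH (hfe n)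
      (isEquivariantNDR_latchingSet_union_range f hX hY (hf n))
  let F : ∀ n, {F // IsPartialExtension f h H n F} := fun n =>
    Nat.rec ⟨F₀, hF₀⟩ (fun n F => ⟨next n F, hnext n F⟩) n
  obtain ⟨F', hF'c, hF'⟩ := exists_extension_of_forall_isPartialExtension
    (F := fun n => (F n).1) (fun n => (F n).2) fun n => hnext' n (F n)
  exact ⟨F', hF'c, (hF' 0).map_smul, (hF' 0).apply_zero, (hF' 0).apply_realizationMap⟩

end SimplicialGSpace

theorem theorem1 {G : Type u} [Group G] [TopologicalSpace G] [IsKTopologicalGroup G]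
    {X Y : SimplicialObject (GSpaceCat G)} (f : X ⟶ Y)
    (hX : SimplicialGSpace.IsReedyCofibrant X) (hY : SimplicialGSpace.IsReedyCofibrant Y)
    (hf : ∀ n : ℕ, IsGCofibration G (f.app (op (SimplexCategory.mk n))).toFun) :
    IsGSpace G (SimplicialGSpace.Realization X) ∧
      IsGSpace G (SimplicialGSpace.Realization Y) ∧
      IsGCofibration G (SimplicialGSpace.realizationMap f) :=
  ⟨SimplicialGSpace.isGSpace_realization X, SimplicialGSpace.isGSpace_realization Y,
    SimplicialGSpace.isGCofibration_realizationMap f hX hY hf⟩
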